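/- Let $p$ be a prime, let $K$ be a $p$-adic field (a finite extension of $\mathbb{Q}_p$), and let $L/K$ be a finite extension which is at most tamely ramified (that is, $p$ does not divide its ramification index). Let $E$ be the Galois closure of $L/K$, let $G=\mathrm{Gal}(E/K)$ and $G_L=\mathrm{Gal}(E/L)$, and suppose that $L/K$ is almost classically Galois, i.e. $G_L$ has a normal complement in $G$. Let $X=G/G_L$ be the set of left cosets, $\bar 1\in X$ the trivial coset, and $\lambda:G\to\mathrm{Perm}(X)$ the left translation map; for $\bar g\in X$ and $x\in L$ write $\bar g[x]=g(x)\in E$. Let $N$ be a subgroup of $\mathrm{Perm}(X)$ normalized by $\lambda(G)$, let $G$ act on the group algebra $E[N]$ through the Galois action on $E$ and through conjugation via $\lambda$ on $N$, and let $H=E[N]^G$, which acts on $L$ by $$\Bigl(\sum_{\eta\in N}c_\eta\,\eta\Bigr)\cdot x=\sum_{\eta\in N}c_\eta\,\eta^{-1}(\bar 1)[x]\qquad(x\in L).$$ Suppose that $H$ is commutative and that, with this action, $H$ gives a Hopf–Galois structure on $L/K$: $L$ is an $H$-module algebra and the $K$-linear map $j:L\otimes_K H\to\mathrm{End}_K(L)$,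 $j(s\otimes h)(t)=s\,(h\cdot t)$, is bijective. (By the theorem of Greither and Pareigis the latter condition means that $N$ is regular on $X$, and every Hopf–Galois structure on $L/K$ arises from such an $N$.) Let $\mathfrak{O}_E$ be the valuation ring of $E$ and let $\mathfrak{O}_E[N]^G=\mathfrak{O}_E[N]\cap H$. Then every fractional ideal $\mathfrak{B}$ of $L$ is stable under the action of $\mathfrak{O}_E[N]^G$ and is a free $\mathfrak{O}_E[N]^G$-module. -/

import Mathlib

open scoped TensorProduct

noncomputable section

namespace HopfGaloisTame

/-! ## `p`-adic fields, rings of integers, tame extensions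

A `p`-adic field is a finite extension of `ℚ_[p]`. -/

/-- The valuation ring of a `p`-adic field `K`: the integral closure of `ℤ_p` in `K`. -/
def padicIntegers (p : ℕ) [Fact p.Prime] (K : Type*) [Field K] [Algebra ℚ_[p] K] : Subring K :=
  (integralClosure (PadicInt.subring p) K).toSubring

/-- The valuation ring of a finite extension `F` of a `p`-adic field `K`: the integral closure in
`F` of the valuation ring of `K`. -/
abbrev extIntegers (p : ℕ) [Fact p.Prime] (K : Type*) [Field K] [Algebra ℚ_[p] K]
    (F : Type*) [Field F] [Algebra K F] : Subalgebra (padicIntegers p K) F :=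
  integralClosure (padicIntegers p K) F

/-- `F / K` is (at most) tamely ramified: `p` does not divide the ramification index of `F / K`.
(The valuation ring of `F` has exactly one maximal ideal; residue fields are finite, so that
residue extensions are separable.) -/
def IsTame (p : ℕ) [Fact p.Prime] (K : Type*) [Field K] [Algebra ℚ_[p] K]
    (F : Type*) [Field F] [Algebra K F] : Prop :=
  ∀ P : Ideal (extIntegers p K F), P.IsMaximal →
    ¬ p ∣ P.ramificationIdx (padicIntegers p K)

section Galois

variable {K E : Type*} [Field K] [Field E] [Algebra K E]

/-- For a Galois closure `E / K` of `L / K`: the subgroup `Gal(E/L)` has a normal complement in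
`Gal(E/K)`. -/
def IsAlmostClassicallyGalois (L : IntermediateField K E) : Prop :=
  ∃ C : Subgroup Gal(E/K), C.Normal ∧ Subgroup.IsComplement' C L.fixingSubgroup

/-- The set `X = Gal(E/K) / Gal(E/L)` of left cosets. -/
abbrev Cosets (L : IntermediateField K E) : Type _ := Gal(E/K) ⧸ L.fixingSubgroup

/-- Left translation `λ : Gal(E/K) → Perm X`. -/
abbrev leftTranslation (L : IntermediateField K E) : Gal(E/K) →* Equiv.Perm (Cosets L) :=
  MulAction.toPermHom Gal(E/K) (Cosets L)

/-- `N ≤ Perm X` is normalized by the image of `λ`. -/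
def IsNormalizedByTranslations {L : IntermediateField K E}
    (N : Subgroup (Equiv.Perm (Cosets L))) : Prop :=
  ∀ g : Gal(E/K), ∀ η ∈ N, leftTranslation L g * η * (leftTranslation L g)⁻¹ ∈ N

/-- The embedding `x ↦ ḡ[x] = g x` of `L` in `E` determined by a coset `ḡ ∈ X`. -/
def cosetEmb {L : IntermediateField K E} (y : Cosets L) : L →ₐ[K] E :=
  Quotient.liftOn' y (fun g => (g : E →ₐ[K] E).comp L.val) (by
    intro a b hab
    rw [QuotientGroup.leftRel_apply] at hab
    ext x
    have h := (IntermediateField.mem_fixingSubgroup_iff L _).1 hab x x.2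
    have h2 : a ((a⁻¹ * b) (x : E)) = a x := by rw [h]
    rw [← AlgEquiv.mul_apply, mul_inv_cancel_left] at h2
    exact h2.symm)

@[simp]
lemma cosetEmb_mk {L : IntermediateField K E} (g : Gal(E/K)) (x : L) :
    cosetEmb (QuotientGroup.mk g : Cosets L) x = g x := rfl

lemma cosetEmb_smul {L : IntermediateField K E} (g : Gal(E/K)) (y : Cosets L) (x : L) :
    cosetEmb (g • y) x = g (cosetEmb y x) := by
  induction y using QuotientGroup.induction_on with
  | H h => rfl

/-- For `y ∈ X` and `x ∈ L`, the `E`-linear functional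
`∑ c_η η ↦ ∑ c_η η⁻¹(y)[x]` on the group algebra `E[N]`. -/
def evalAt {L : IntermediateField K E} (N : Subgroup (Equiv.Perm (Cosets L)))
    (y : Cosets L) (x : L) : MonoidAlgebra E N →ₗ[E] E :=
  (Finsupp.linearCombination E
    (fun η : N => cosetEmb ((η : Equiv.Perm (Cosets L))⁻¹ y) x)).comp
      (MonoidAlgebra.coeffLinearEquiv E).toLinearMap

section Action

variable {L : IntermediateField K E} {N : Subgroup (Equiv.Perm (Cosets L))}

lemma evalAt_apply (y : Cosets L) (x : L) (z : MonoidAlgebra E N) :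
    evalAt N y x z =
      z.coeff.sum (fun η c => c * cosetEmb ((η : Equiv.Perm (Cosets L))⁻¹ y) x) := rfl

@[simp]
lemma evalAt_single (y : Cosets L) (x : L) (η : N) (c : E) :
    evalAt N y x (MonoidAlgebra.single η c) =
      c * cosetEmb ((η : Equiv.Perm (Cosets L))⁻¹ y) x := by
  simp [evalAt_apply]

/-- Conjugation by `λ(g)` on `N`. -/
def conjHom (hN : IsNormalizedByTranslations N) (g : Gal(E/K)) : N →* N :=
  ((MulAut.conj (leftTranslation L g)).toMonoidHom.comp N.subtype).codRestrict N
    (fun η => hN g η η.2)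

/-- The action of `g ∈ Gal(E/K)` on `E[N]`: `∑ c_η η ↦ ∑ g(c_η) λ(g) η λ(g)⁻¹`. -/
def galAct (hN : IsNormalizedByTranslations N) (g : Gal(E/K)) :
    MonoidAlgebra E N →ₐ[K] MonoidAlgebra E N :=
  (MonoidAlgebra.mapDomainAlgHom K E (conjHom hN g)).comp
    (MonoidAlgebra.mapAlgHom N (g : E →ₐ[K] E))

lemma galAct_single (hN : IsNormalizedByTranslations N) (g : Gal(E/K)) (η : N) (c : E) :
    galAct hN g (MonoidAlgebra.single η c) = MonoidAlgebra.single (conjHom hN g η) (g c) := by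
  simp [galAct]

/-- The `K`-algebra `H = E[N]^G` of fixed points of `G = Gal(E/K)` on `E[N]`. -/
def fixedAlgebra (hN : IsNormalizedByTranslations N) : Subalgebra K (MonoidAlgebra E N) :=
  ⨅ g : Gal(E/K), AlgHom.equalizer (galAct hN g) (AlgHom.id K _)

lemma mem_fixedAlgebra {hN : IsNormalizedByTranslations N} {z : MonoidAlgebra E N} :
    z ∈ fixedAlgebra hN ↔ ∀ g : Gal(E/K), galAct hN g z = z := by
  simp [fixedAlgebra, Algebra.mem_iInf, AlgHom.mem_equalizer]

/-- The integral group ring `Λ = 𝔒_E[N]`, as a subring of `E[N]`. -/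
def integralGroupRing (p : ℕ) [Fact p.Prime] [Algebra ℚ_[p] K]
    (N : Subgroup (Equiv.Perm (Cosets L))) : Subring (MonoidAlgebra E N) where
  carrier := {z | ∀ η : N, z.coeff η ∈ extIntegers p K E}
  zero_mem' := fun η => by simp
  one_mem' := fun η => by
    classical
    rw [MonoidAlgebra.one_def, MonoidAlgebra.coeff_single, Finsupp.single_apply]
    split_ifs
    · exact one_mem _
    · exact zero_mem _
  add_mem' := fun {z w} hz hw η => add_mem (hz η) (hw η)
  neg_mem' := fun {z} hz η => neg_mem (hz η)
  mul_mem' := fun {z w} hz hw η => by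
    classical
    rw [MonoidAlgebra.coeff_mul]
    refine sum_mem fun a _ => sum_mem fun b _ => ?_
    dsimp only
    split_ifs
    · exact mul_mem (hz a) (hw b)
    · exact zero_mem _

/-- `Λ^G = 𝔒_E[N]^G`, as a subring of `H = E[N]^G`. -/
def integralFixedRing (p : ℕ) [Fact p.Prime] [Algebra ℚ_[p] K]
    (hN : IsNormalizedByTranslations N) : Subring (fixedAlgebra hN) :=
  (integralGroupRing p N).comap (fixedAlgebra hN).val.toRingHom

lemma galois_evalAt (hN : IsNormalizedByTranslations N) (g : Gal(E/K)) (y : Cosets L) (x : L)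
    (z : MonoidAlgebra E N) :
    g (evalAt N y x z) = evalAt N (g • y) x (galAct hN g z) := by
  induction z using MonoidAlgebra.induction_linear with
  | zero => simp
  | add a b ha hb => simp [ha, hb]
  | single η c =>
    rw [galAct_single, evalAt_single, evalAt_single, map_mul, ← cosetEmb_smul]
    congr 3
    simp [conjHom]

lemma galois_evalAt_of_mem {hN : IsNormalizedByTranslations N} (g : Gal(E/K)) (y : Cosets L)
    (x : L) (z : fixedAlgebra hN) :
    g (evalAt N y x z) = evalAt N (g • y) x z := by
  rw [galois_evalAt hN, mem_fixedAlgebra.1 z.2 g]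

lemma evalAt_mem [FiniteDimensional K E] [IsGalois K E] {hN : IsNormalizedByTranslations N}
    (z : fixedAlgebra hN) (x : L) :
    evalAt N (QuotientGroup.mk 1) x z ∈ L := by
  suffices h : evalAt N (QuotientGroup.mk 1) x (z : MonoidAlgebra E N) ∈
      IntermediateField.fixedField L.fixingSubgroup from
    (IsGalois.fixedField_fixingSubgroup L).le h
  rw [IntermediateField.mem_fixedField_iff]
  intro g hg
  rw [galois_evalAt_of_mem]
  congr 2
  change (QuotientGroup.mk (g * 1) : Cosets L) = QuotientGroup.mk 1
  rw [QuotientGroup.eq]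
  simpa using hg

lemma evalAt_single_mul (y : Cosets L) (x : L) (η : N) (c : E) (w : MonoidAlgebra E N) :
    evalAt N y x (MonoidAlgebra.single η c * w) =
      c * evalAt N ((η : Equiv.Perm (Cosets L))⁻¹ y) x w := by
  induction w using MonoidAlgebra.induction_linear with
  | zero => simp
  | add a b ha hb => simp [ha, hb, mul_add]
  | single ν d => simp [MonoidAlgebra.single_mul_single, mul_assoc]

variable [FiniteDimensional K E] [IsGalois K E]

lemma evalAt_mul {hN : IsNormalizedByTranslations N} (y : Cosets L) (x : L)
    (z : MonoidAlgebra E N) (w : fixedAlgebra hN) :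
    evalAt N y x (z * w) =
      evalAt N y ⟨evalAt N (QuotientGroup.mk 1) x w, evalAt_mem w x⟩ z := by
  induction z using MonoidAlgebra.induction_linear with
  | zero => simp
  | add a b ha hb => simp [ha, hb, add_mul]
  | single η c =>
    rw [evalAt_single_mul, evalAt_single]
    congr 1
    obtain ⟨g, hg⟩ := QuotientGroup.mk_surjective ((η : Equiv.Perm (Cosets L))⁻¹ y)
    rw [← hg, cosetEmb_mk]
    rw [galois_evalAt_of_mem]
    congr 2

/-- The action of a single element of `H` on `L`, as a `K`-linear map. -/
def actionEnd {hN : IsNormalizedByTranslations N} (z : fixedAlgebra hN) : Module.End K L where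
  toFun := fun x => ⟨evalAt N (QuotientGroup.mk 1) x z, evalAt_mem z x⟩
  map_add' := fun x x' => Subtype.ext (by simp [evalAt_apply, mul_add, Finsupp.sum_add])
  map_smul' := fun k x => Subtype.ext (by simp [evalAt_apply, Finsupp.smul_sum])

lemma coe_actionEnd {hN : IsNormalizedByTranslations N} (z : fixedAlgebra hN) (x : L) :
    (actionEnd z x : E) = evalAt N (QuotientGroup.mk 1) x z := rfl

/-- The action of `H = E[N]^G` on `L`:
`(∑ c_η η) · x = ∑ c_η η⁻¹(1̄)[x]`. -/
def action (hN : IsNormalizedByTranslations N) : fixedAlgebra hN →ₐ[K] Module.End K L :=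
  AlgHom.ofLinearMap
    { toFun := actionEnd
      map_add' := fun z z' => by
        refine LinearMap.ext fun x => Subtype.ext ?_
        simp [coe_actionEnd]
      map_smul' := fun k z => by
        refine LinearMap.ext fun x => Subtype.ext ?_
        simp [coe_actionEnd] }
    (LinearMap.ext fun x => Subtype.ext (by
      simp [coe_actionEnd, MonoidAlgebra.one_def]))
    (fun z w => LinearMap.ext fun x => Subtype.ext (evalAt_mul (QuotientGroup.mk 1) x z.1 w))

/-- `L` as a module over `H = E[N]^G`. -/
instance instModuleFixedAlgebra (hN : IsNormalizedByTranslations N) :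
    Module (fixedAlgebra hN) L :=
  Module.compHom L (action hN).toRingHom

lemma coe_smul {hN : IsNormalizedByTranslations N} (z : fixedAlgebra hN) (x : L) :
    ((z • x : L) : E) = (z : MonoidAlgebra E N).coeff.sum (fun η c =>
      c * cosetEmb ((η : Equiv.Perm (Cosets L))⁻¹ (QuotientGroup.mk 1)) x) := rfl

/-- The `K`-linear map `j : L ⊗_K H → End_K(L)`, `j(s ⊗ h)(t) = s (h · t)`. -/
def jMap (hN : IsNormalizedByTranslations N) :
    L ⊗[K] fixedAlgebra hN →ₗ[K] Module.End K L :=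
  TensorProduct.lift
    (((LinearMap.mul K (Module.End K L)).comp (LinearMap.mul K L)).compl₂
      (action hN).toLinearMap)

lemma jMap_tmul (hN : IsNormalizedByTranslations N) (s t : L) (h : fixedAlgebra hN) :
    jMap hN (s ⊗ₜ h) t = s * (h • t) := rfl

/-- `H = E[N]^G`, acting on `L` as above, gives a Hopf–Galois structure on `L / K`: `L` is an
`H`-module algebra, and `j : L ⊗_K H → End_K(L)` is bijective.  The Hopf algebra structure of `H`
is the one obtained by descent from the group algebra `E[N]`, so that the counit and the
comultiplication of `h ∈ H` are computed in `E[N]`; in the second condition,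
`∑ (h₍₁₎ · s) (h₍₂₎ · t)` is therefore the value at `Δ(h) ∈ E[N] ⊗_E E[N]` of the functional
`u ⊗ v ↦ (u · s) (v · t)`, where `(∑ c_η η) · s = ∑ c_η η⁻¹(1̄)[s]` for all of `E[N]`. -/
structure GivesHopfGaloisStructure (hN : IsNormalizedByTranslations N) : Prop where
  smul_one : ∀ h : fixedAlgebra hN,
    ((h • (1 : L) : L) : E) = Coalgebra.counit (R := E) (h : MonoidAlgebra E N)
  smul_mul : ∀ (h : fixedAlgebra hN) (s t : L),
    ((h • (s * t) : L) : E) =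
      LinearMap.mul' E E
        (TensorProduct.map (evalAt N (QuotientGroup.mk 1) s) (evalAt N (QuotientGroup.mk 1) t)
          (Coalgebra.comul (R := E) (h : MonoidAlgebra E N)))
  bijective : Function.Bijective (jMap hN)

end Action

end Galois

end HopfGaloisTame

end

noncomputable section

namespace HopfGaloisTame

section

/-! ## Group algebras of finite abelian groups over valued fields -/

section GroupAlgebra

variable {N Ω : Type*} [CommGroup N] [Field Ω]

/-! Commutativity of `H` descends to `N`, since `H` spans `E[N]` over `E`. Surjectivity of `j` makes
`N` transitive, because the embeddings of `L` are linearly independent; a commutative transitive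
group is regular. So with `Ω` an algebraic closure of `E`, sending `x` to `∑ η(1̄)[x] η` embeds `L`
in `Ω[N]` and turns the action of `H` into multiplication. A nonzero fractional ideal `B` becomes a
lattice in a commutative group algebra, and a generator `t` is sought there.

Write `|N| = p ^ a * m` with `p ∤ m`. The characters `ψ` of order dividing `m` give integral
idempotents `e_ψ` with sum `1`, and an element of the integral group ring is a unit as soon as every
such `ψ` takes it to a unit (`exists_integral_inverse`). So it suffices to find, for each `ψ`, an `x
∈ B` such that `ψ(x)` is at least as large as every coefficient of every element of `e_ψ B`. These
are glued along Galois orbits of characters, by orbit idempotents lying in `H`, to one `t`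
(`exists_generator`); quotients by `t` are Galois invariant and so descend to `𝔒_E[N]^G`.

Tameness supplies the local generators. The elements of `G` that move `1̄` within its `N[m]`-orbit
form a subgroup of index `p ^ a`; its fixed field `F ⊆ L` has degree `p ^ a` over `K`, while its
ramification index divides a number prime to `p`. Hence `F / K` is unramified, and its embeddings,
indexed by `N / N[m]`, remain distinct modulo the maximal ideal (`algHom_eq_of_isTame`). If `x₀ ∈ B`
has the largest coefficient in its `e_ψ`-component, Dedekind independence over the residue field
gives an integer `r` of `F` for which no cancellation occurs in `ψ(r x₀)`
(`exists_valuation_sum_eq_one`, `exists_charEval_max`). -/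

/-- The `Ω`-algebra homomorphism `Ω[N] → Ω` defined by a character of `N`. -/
def charEval (ψ : N →* Ωˣ) : MonoidAlgebra Ω N →ₐ[Ω] Ω :=
  MonoidAlgebra.lift Ω Ω N ((Units.coeHom Ω).comp ψ)

@[simp]
lemma charEval_single (ψ : N →* Ωˣ) (η : N) (c : Ω) :
    charEval ψ (MonoidAlgebra.single η c) = c * ψ η := by
  simp [charEval]

lemma charEval_apply [Fintype N] (ψ : N →* Ωˣ) (z : MonoidAlgebra Ω N) :
    charEval ψ z = ∑ η, z.coeff η * ψ η := by
  rw [charEval, MonoidAlgebra.lift_apply, Finsupp.sum_fintype _ _ (by simp)]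
  simp

lemma coeff_mul_eq_sum [Fintype N] (z w : MonoidAlgebra Ω N) (ν : N) :
    (z * w).coeff ν = ∑ η, z.coeff η * w.coeff (η⁻¹ * ν) := by
  classical
  rw [MonoidAlgebra.coeff_mul, Finsupp.sum_fintype _ _ (by simp)]
  refine Finset.sum_congr rfl fun η _ => ?_
  rw [Finsupp.sum_fintype _ _ (by simp), Finset.sum_eq_single (η⁻¹ * ν)]
  · simp
  · intro b _ hb
    rw [if_neg]
    rintro rfl
    simp at hb
  · simp

variable (Ω) in
/-- The element `∑ f(η) η` of the group algebra of a finite group. -/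
def ofFun [Finite N] (f : N → Ω) : MonoidAlgebra Ω N :=
  MonoidAlgebra.ofCoeff (Finsupp.equivFunOnFinite.symm f)

omit [CommGroup N] in
@[simp]
lemma coeff_ofFun [Finite N] (f : N → Ω) (η : N) : (ofFun Ω f).coeff η = f η := rfl

omit [CommGroup N] in
lemma ext_coeff {z w : MonoidAlgebra Ω N} (h : ∀ η, z.coeff η = w.coeff η) : z = w :=
  MonoidAlgebra.coeff_injective (Finsupp.ext h)

variable (N Ω) in
/-- The group of characters of `N` of order dividing `m`. -/
abbrev charTorsion (m : ℕ) : Subgroup (N →* Ωˣ) := (powMonoidHom m : (N →* Ωˣ) →* _).ker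

lemma charTorsion_pow {m : ℕ} (ψ : charTorsion N Ω m) (η : N) : (ψ.1 η) ^ m = 1 := by
  have := DFunLike.congr_fun ψ.2 η
  simpa using this

instance finite_charTorsion [Finite N] [IsAlgClosed Ω] [CharZero Ω] (m : ℕ) :
    Finite (charTorsion N Ω m) := by
  have : NeZero (Monoid.exponent N) := ⟨Monoid.exponent_ne_zero_of_finite⟩
  have h := CommGroup.card_monoidHom_of_hasEnoughRootsOfUnity N Ω
  have : Finite (N →* Ωˣ) := Nat.finite_of_card_ne_zero (by rw [h]; exact Nat.card_pos.ne')
  infer_instance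

variable (v : Valuation Ω NNReal)

lemma valuation_coeff_mul_le [Finite N] {z w : MonoidAlgebra Ω N} {r : NNReal}
    (hz : ∀ η, v (z.coeff η) ≤ 1) (hw : ∀ η, v (w.coeff η) ≤ r) (η : N) :
    v ((z * w).coeff η) ≤ r := by
  have := Fintype.ofFinite N
  rw [coeff_mul_eq_sum]
  refine v.map_sum_le fun i _ => ?_
  rw [map_mul]
  exact (mul_le_mul' (hz _) (hw _)).trans_eq (one_mul r)

/-! ### Units of the integral group ring -/

section Unit

variable {p a m : ℕ}

/-- If `u ≠ 1` is an `m`-th root of unity, then `1 + u + ... + u ^ (m - 1) = 0`; were `u` to reduce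
to `1`, this would read `m = 0` in `k`. Surjectivity is a count: `m` roots in `R` and at most `m` in
`k`. -/
lemma restrictRootsOfUnity_bijective {R k : Type*} [CommRing R] [IsDomain R] [Field k]
    (r : R →+* k) {m : ℕ} (hm : (m : k) ≠ 0) {ζ : R} (hζ : IsPrimitiveRoot ζ m) :
    Function.Bijective (restrictRootsOfUnity r m) := by
  have : NeZero m := ⟨fun h => hm (by simp [h])⟩
  have hinj : Function.Injective (restrictRootsOfUnity r m) := by
    rw [injective_iff_map_eq_one]
    rintro ⟨u, hu⟩ h
    have hu1 : ((u : R)) ^ m = 1 := by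
      rw [mem_rootsOfUnity] at hu
      rw [← Units.val_pow_eq_pow_val, hu, Units.val_one]
    have h1 : r u = 1 := by
      have := congrArg (fun x : rootsOfUnity m k => ((x : kˣ) : k)) h
      simpa using this
    by_contra hne
    have hne' : (u : R) - 1 ≠ 0 := by
      intro h0
      apply hne
      ext
      simpa [sub_eq_zero] using h0
    have hs : ∑ i ∈ Finset.range m, (u : R) ^ i = 0 := by
      have := mul_geom_sum (u : R) m
      rw [hu1, sub_self] at this
      exact (mul_eq_zero.1 this).resolve_left hne'
    have := congrArg r hs
    simp [h1] at this
    exact hm this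
  refine ⟨hinj, ?_⟩
  have : Finite (rootsOfUnity m k) := inferInstance
  have hle := card_rootsOfUnity k m
  have hcard := hζ.card_rootsOfUnity
  have h2 := Nat.card_le_card_of_injective _ hinj
  exact (Function.Injective.bijective_of_nat_card_le hinj (by omega)).2

lemma valuationSubring_isUnit_iff (x : v.valuationSubring) : IsUnit x ↔ v (x : Ω) = 1 := by
  constructor
  · rintro h
    obtain ⟨y, hy⟩ := h.exists_right_inv
    have h1 : v (x : Ω) * v (y : Ω) = 1 := by
      rw [← map_mul, ← map_one v]
      exact congrArg (fun z : v.valuationSubring => v (z : Ω)) hy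
    refine le_antisymm ((v.mem_valuationSubring_iff _).1 x.2) ?_
    rw [← h1]
    exact mul_le_of_le_one_right' ((v.mem_valuationSubring_iff _).1 y.2)
  · intro h
    have hx : (x : Ω) ≠ 0 := by
      intro h0
      simp [h0] at h
    refine IsUnit.of_mul_eq_one ⟨(x : Ω)⁻¹, (v.mem_valuationSubring_iff _).2 (by simp [h])⟩ ?_
    ext
    simp [hx]

/-- A homomorphism from an integral group ring to a field of positive characteristic is the
reduction of a character of order prime to the characteristic. -/
lemma exists_charTorsion_lift [Fintype N] [IsAlgClosed Ω] [CharZero Ω] (hp : p.Prime)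
    (hvp : v p < 1) (hvm : v m = 1) (hN : ∀ η : N, η ^ (p ^ a * m) = 1)
    {k : Type*} [Field k] (F : MonoidAlgebra v.valuationSubring N →+* k)
    (hF : ∀ x : v.valuationSubring, F (algebraMap _ _ x) = 0 ↔ v (x : Ω) < 1) :
    ∃ ψ : charTorsion N Ω m, ∀ θ : MonoidAlgebra v.valuationSubring N, F θ = 0 →
      v (∑ η, (θ.coeff η : Ω) * ψ.1 η) < 1 := by
  let R := v.valuationSubring
  have hm0 : m ≠ 0 := by
    rintro rfl
    simp at hvm
  have : NeZero m := ⟨hm0⟩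
  let r : R →+* k := F.comp (algebraMap R (MonoidAlgebra R N))
  have hker : ∀ x : R, r x = 0 ↔ v (x : Ω) < 1 := hF
  have hpk : (p : k) = 0 := by
    have := (hker (p : R)).2 (by simpa using hvp)
    simpa using this
  have hmk : (m : k) ≠ 0 := by
    have := (hker (m : R)).not.2 (by simp [hvm])
    simpa using this
  have : CharP k p := by
    refine (ringChar.of_eq ?_)
    have h1 : ringChar k ∣ p := (ringChar.spec k p).1 hpk
    exact (hp.eq_one_or_self_of_dvd _ h1).resolve_left CharP.ringChar_ne_one
  have : Fact p.Prime := ⟨hp⟩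
  let f : N →* kˣ := ((F : MonoidAlgebra R N →* k).comp (MonoidAlgebra.of R N)).toHomUnits
  have hf : ∀ η, f η ∈ rootsOfUnity m k := by
    intro η
    rw [mem_rootsOfUnity]
    have h1 : (f η) ^ (m * p ^ a) = 1 := by rw [mul_comm, ← map_pow, hN, map_one]
    have h2 : ((f η : k) ^ m) ^ p ^ a = 1 := by
      rw [← pow_mul (f η : k)]
      exact congrArg Units.val h1
    ext
    rw [Units.val_pow_eq_pow_val, Units.val_one]
    -- The `p`-part of the order is invisible in `k`, where Frobenius is injective.
    apply iterateFrobenius_inj k p a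
    rw [iterateFrobenius_def, iterateFrobenius_def, h2, one_pow]
  obtain ⟨ζ, hζ⟩ := HasEnoughRootsOfUnity.exists_primitiveRoot Ω m
  have hvζ : v ζ = 1 := by
    have := congrArg v hζ.pow_eq_one
    rw [map_pow, map_one] at this
    exact (pow_eq_one_iff_of_nonneg zero_le hm0).1 this
  have hζR : IsPrimitiveRoot (⟨ζ, (v.mem_valuationSubring_iff _).2 hvζ.le⟩ : R) m :=
    IsPrimitiveRoot.of_map_of_injective (f := R.subtype) hζ Subtype.val_injective
  let e := MulEquiv.ofBijective _ (restrictRootsOfUnity_bijective r hmk hζR)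
  -- Lift the values in `k` to the unique `m`-th roots of unity above them.
  let g : N →* Rˣ :=
    (rootsOfUnity m R).subtype.comp (e.symm.toMonoidHom.comp (f.codRestrict _ hf))
  have hg : ∀ η, r (g η) = f η := by
    intro η
    have := e.apply_symm_apply (f.codRestrict _ hf η)
    exact congrArg (fun x : rootsOfUnity m k => ((x : kˣ) : k)) this
  have hgm : ∀ η, (g η) ^ m = 1 := fun η =>
    (mem_rootsOfUnity _ _).1 (e.symm (f.codRestrict _ hf η)).2
  refine ⟨⟨(Units.map (R.subtype : R →* Ω)).comp g, ?_⟩, fun θ hθ => ?_⟩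
  · rw [MonoidHom.mem_ker]
    ext η
    change ((Units.map (R.subtype : R →* Ω) (g η) ^ m : Ωˣ) : Ω) = 1
    rw [← map_pow, hgm, map_one, Units.val_one]
  have hval : r (∑ η, θ.coeff η * g η) = 0 := by
    rw [map_sum, ← hθ]
    have hsum : θ = ∑ η, algebraMap R _ (θ.coeff η) * MonoidAlgebra.of R N η := by
      classical
      refine MonoidAlgebra.coeff_injective (Finsupp.ext fun ν => ?_)
      rw [MonoidAlgebra.coeff_sum, Finsupp.finsetSum_apply]
      simp [Finsupp.single_apply]
    conv_rhs => rw [hsum, map_sum]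
    refine Finset.sum_congr rfl fun η _ => ?_
    rw [map_mul, map_mul, hg]
    rfl
  rw [hker] at hval
  convert hval using 2
  push_cast
  rfl

/-- An integral element of a group algebra which is a unit at all characters of order prime to the
residue characteristic is a unit of the integral group ring. -/
lemma exists_integral_inverse [Finite N] [IsAlgClosed Ω] [CharZero Ω] (hp : p.Prime)
    (hvp : v p < 1) (hvm : v m = 1)
    (hN : ∀ η : N, η ^ (p ^ a * m) = 1) {θ : MonoidAlgebra Ω N} (hθ : ∀ η, v (θ.coeff η) ≤ 1)
    (hunit : ∀ ψ : charTorsion N Ω m, v (charEval ψ.1 θ) = 1) :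
    ∃ θ' : MonoidAlgebra Ω N, (∀ η, v (θ'.coeff η) ≤ 1) ∧ θ * θ' = 1 := by
  have := Fintype.ofFinite N
  set R := v.valuationSubring
  let incl : MonoidAlgebra R N →+* MonoidAlgebra Ω N := MonoidAlgebra.mapRingHom N R.subtype
  have hincl : ∀ (z : MonoidAlgebra R N) (η : N), (incl z).coeff η = z.coeff η := fun z η => by
    simp [incl]
  let θR : MonoidAlgebra R N :=
    MonoidAlgebra.ofCoeff (Finsupp.equivFunOnFinite.symm
      (fun η => (⟨θ.coeff η, (v.mem_valuationSubring_iff _).2 (hθ η)⟩ : R)))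
  have hθR : incl θR = θ := ext_coeff fun η => by rw [hincl]; rfl
  suffices h : IsUnit θR by
    obtain ⟨θ', h'⟩ := h.exists_right_inv
    refine ⟨incl θ', fun η => ?_, ?_⟩
    · rw [hincl]
      exact (v.mem_valuationSubring_iff _).1 (θ'.coeff η).2
    · rw [← hθR, ← map_mul, h', map_one]
  by_contra hnon
  obtain ⟨M, hM, hmem⟩ := exists_max_ideal_of_mem_nonunits (a := θR) hnon
  obtain ⟨ψ, hψ⟩ := @exists_charTorsion_lift N Ω _ _ v p a m _ _ _ hp hvp hvm hN _
    (Ideal.Quotient.field M) (Ideal.Quotient.mk M) (by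
      intro x
      have h1 : Ideal.Quotient.mk M (algebraMap _ _ x) = 0 ↔
          x ∈ M.comap (algebraMap R (MonoidAlgebra R N)) := by
        rw [Ideal.mem_comap, Ideal.Quotient.eq_zero_iff_mem]
      refine h1.trans ?_
      -- `R[N]` is integral over the local ring `R`, so `M` lies over its maximal ideal.
      rw [IsLocalRing.eq_maximalIdeal
        (Ideal.isMaximal_comap_of_isIntegral_of_isMaximal (R := R) M)]
      rw [IsLocalRing.mem_maximalIdeal, mem_nonunits_iff, valuationSubring_isUnit_iff]
      exact ⟨fun h => lt_of_le_of_ne ((v.mem_valuationSubring_iff _).1 x.2) h, fun h => h.ne⟩)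
  refine (hψ θR (Ideal.Quotient.eq_zero_iff_mem.2 hmem)).ne ?_
  rw [← hunit ψ, charEval_apply]
  rfl

end Unit

end GroupAlgebra

end

/-! ### Idempotents of characters of order prime to `p` -/

section

section Idempotents

variable {N Ω : Type*} [CommGroup N] [Field Ω]

variable (N) in
/-- The subgroup of elements of order dividing `m`. -/
abbrev torsionPart (m : ℕ) : Subgroup N := (powMonoidHom m : N →* N).ker

lemma mem_torsionPart {m : ℕ} {η : N} : η ∈ torsionPart N m ↔ η ^ m = 1 := Iff.rfl

open Classical in
/-- The idempotent of the group algebra attached to a character of order dividing `m`. -/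
def charIdem {m : ℕ} [Finite N] (ψ : charTorsion N Ω m) : MonoidAlgebra Ω N :=
  letI := Fintype.ofFinite N
  (m : Ω)⁻¹ • ∑ τ : torsionPart N m, MonoidAlgebra.single (τ : N) ((ψ.1 τ⁻¹ : Ωˣ) : Ω)

section

variable {m : ℕ} [Fintype N]

lemma charIdem_eq [Fintype (torsionPart N m)] (ψ : charTorsion N Ω m) :
    charIdem ψ = (m : Ω)⁻¹ • ∑ τ : torsionPart N m,
      MonoidAlgebra.single (τ : N) ((ψ.1 τ⁻¹ : Ωˣ) : Ω) := by
  rw [charIdem]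
  congr!

lemma coeff_charIdem [DecidableEq N] (ψ : charTorsion N Ω m) (η : N) :
    (charIdem ψ).coeff η = if η ^ m = 1 then (m : Ω)⁻¹ * ((ψ.1 η⁻¹ : Ωˣ) : Ω) else 0 := by
  classical
  rw [charIdem_eq, MonoidAlgebra.coeff_smul_apply, MonoidAlgebra.coeff_sum,
    Finsupp.finsetSum_apply]
  simp only [MonoidAlgebra.coeff_single, Finsupp.single_apply]
  split_ifs with h
  · rw [Finset.sum_eq_single (⟨η, h⟩ : torsionPart N m)]
    · simp
    · intro b _ hb
      rw [if_neg]
      exact fun h' => hb (Subtype.ext h')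
    · simp
  · rw [Finset.sum_eq_zero, smul_zero]
    intro b _
    rw [if_neg]
    rintro rfl
    exact h b.2

lemma coeff_charIdem_mul [Fintype (torsionPart N m)] (ψ : charTorsion N Ω m)
    (z : MonoidAlgebra Ω N) (η : N) :
    (charIdem ψ * z).coeff η =
      (m : Ω)⁻¹ * ∑ τ : torsionPart N m, ((ψ.1 τ⁻¹ : Ωˣ) : Ω) * z.coeff ((τ : N)⁻¹ * η) := by
  rw [charIdem_eq, smul_mul_assoc, Finset.sum_mul, MonoidAlgebra.coeff_smul_apply,
    MonoidAlgebra.coeff_sum, Finsupp.finsetSum_apply, smul_eq_mul]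
  congr 1
  refine Finset.sum_congr rfl fun τ _ => ?_
  rw [MonoidAlgebra.coeff_single_mul_eq_mul_coeff ((τ : N)⁻¹ * η)]
  intro x _
  rw [eq_inv_mul_iff_mul_eq]

/-- Reindexing the sum over `N[m]`. It follows that `coeff η * ψ η` is constant on cosets of `N[m]`
for any element of the `ψ`-component. -/
lemma coeff_charIdem_mul_translate (ψ : charTorsion N Ω m)
    (z : MonoidAlgebra Ω N) (η : N) {σ : N} (hσ : σ ^ m = 1) :
    (charIdem ψ * z).coeff (σ * η) = ((ψ.1 σ⁻¹ : Ωˣ) : Ω) * (charIdem ψ * z).coeff η := by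
  classical
  rw [coeff_charIdem_mul, coeff_charIdem_mul, mul_left_comm]
  refine congrArg ((m : Ω)⁻¹ * ·) ?_
  rw [Finset.mul_sum]
  refine Fintype.sum_equiv (Equiv.mulLeft (⟨σ, hσ⟩ : torsionPart N m)⁻¹) _ _ fun τ => ?_
  simp only [Equiv.coe_mulLeft, Subgroup.coe_mul, InvMemClass.coe_inv]
  have h1 : σ⁻¹ * (σ⁻¹ * (τ : N))⁻¹ = (τ : N)⁻¹ := by simp [mul_comm]
  have h2 : (σ⁻¹ * (τ : N))⁻¹ * η = (τ : N)⁻¹ * (σ * η) := by simp [mul_assoc]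
  rw [← mul_assoc ((ψ.1 σ⁻¹ : Ωˣ) : Ω), ← Units.val_mul, ← map_mul, h1, h2]

variable {v : Valuation Ω NNReal}

omit [Fintype N] in
lemma valuation_char (ψ : charTorsion N Ω m) (hm : m ≠ 0) (η : N) :
    v ((ψ.1 η : Ωˣ) : Ω) = 1 := by
  have h := charTorsion_pow ψ η
  have h2 := congrArg (fun x : Ωˣ => v (x : Ω)) h
  simp only [Units.val_pow_eq_pow_val, map_pow, Units.val_one, map_one] at h2
  exact (pow_eq_one_iff_of_nonneg zero_le hm).1 h2

lemma valuation_charIdem_le (hvm : v m = 1) (ψ : charTorsion N Ω m) (η : N) :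
    v ((charIdem ψ).coeff η) ≤ 1 := by
  classical
  have hm0 : m ≠ 0 := by
    rintro rfl
    simp at hvm
  rw [coeff_charIdem]
  split_ifs
  · rw [map_mul, map_inv₀, hvm, valuation_char ψ hm0]
    simp
  · simp

lemma valuation_charEval_le (hm : m ≠ 0) (ψ : charTorsion N Ω m) {z : MonoidAlgebra Ω N}
    {r : NNReal} (hz : ∀ η, v (z.coeff η) ≤ r) : v (charEval ψ.1 z) ≤ r := by
  rw [charEval_apply]
  refine v.map_sum_le fun η _ => ?_
  rw [map_mul, valuation_char ψ hm, mul_one]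
  exact hz η

variable {p a : ℕ}

omit [Fintype N] in
-- Since `η ^ p ^ a` is `m`-torsion, `(ψ / χ) η` has order dividing both `p ^ a` and `m`.
lemma charTorsion_ext (hpm : Nat.Coprime (p ^ a) m) (hN : ∀ η : N, η ^ (p ^ a * m) = 1)
    {ψ χ : charTorsion N Ω m} (h : ∀ τ : torsionPart N m, ψ.1 τ = χ.1 τ) : ψ = χ := by
  refine Subtype.ext (MonoidHom.ext fun η => ?_)
  rw [← div_eq_one, ← orderOf_eq_one_iff, ← Nat.dvd_one, ← hpm.gcd_eq_one]
  refine Nat.dvd_gcd ?_ ?_ <;> rw [orderOf_dvd_iff_pow_eq_one, div_pow]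
  · have := h ⟨η ^ p ^ a, by rw [mem_torsionPart, ← pow_mul, hN]⟩
    rw [← map_pow, ← map_pow, this, div_self']
  · rw [charTorsion_pow, charTorsion_pow, div_self']

omit [Fintype N] in
lemma sum_char_mul_char [Fintype (torsionPart N m)] [DecidableEq (charTorsion N Ω m)]
    (hpm : Nat.Coprime (p ^ a) m)
    (hN : ∀ η : N, η ^ (p ^ a * m) = 1) (hcard : Nat.card (torsionPart N m) = m)
    (ψ χ : charTorsion N Ω m) :
    ∑ τ : torsionPart N m, ((ψ.1 τ⁻¹ : Ωˣ) : Ω) * ((χ.1 τ : Ωˣ) : Ω) =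
      if ψ = χ then (m : Ω) else 0 := by
  classical
  let f : torsionPart N m →* Ω := (Units.coeHom Ω).comp ((ψ⁻¹ * χ).1.comp (Subgroup.subtype _))
  have hf : ∀ τ : torsionPart N m, ((ψ.1 τ⁻¹ : Ωˣ) : Ω) * ((χ.1 τ : Ωˣ) : Ω) = f τ := by
    intro τ
    simp [f]
  rw [Finset.sum_congr rfl fun τ _ => hf τ, sum_hom_units]
  have : f = 1 ↔ ψ = χ := by
    constructor
    · intro h
      refine charTorsion_ext hpm hN fun τ => ?_
      have := DFunLike.congr_fun h τ
      simp only [f, MonoidHom.comp_apply, MonoidHom.one_apply, Units.coeHom_apply,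
        Units.val_eq_one] at this
      exact (inv_mul_eq_one.1 this)
    · rintro rfl
      ext τ
      simp [f]
  rw [Nat.card_eq_fintype_card] at hcard
  simp only [this, hcard]
  split_ifs <;> simp

lemma charEval_charIdem [CharZero Ω] [DecidableEq (charTorsion N Ω m)]
    (hpm : Nat.Coprime (p ^ a) m)
    (hN : ∀ η : N, η ^ (p ^ a * m) = 1) (hcard : Nat.card (torsionPart N m) = m) (hm : m ≠ 0)
    (ψ χ : charTorsion N Ω m) :
    charEval ψ.1 (charIdem χ) = if χ = ψ then 1 else 0 := by
  classical
  rw [charIdem_eq, map_smul, map_sum]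
  simp only [charEval_single, sum_char_mul_char hpm hN hcard χ ψ]
  split_ifs
  · rw [smul_eq_mul, inv_mul_cancel₀ (by exact_mod_cast hm)]
  · simp

lemma single_mul_charIdem (ψ : charTorsion N Ω m) {τ : N} (hτ : τ ^ m = 1) :
    MonoidAlgebra.single τ 1 * charIdem ψ = ((ψ.1 τ : Ωˣ) : Ω) • charIdem ψ := by
  refine ext_coeff fun η => ?_
  rw [MonoidAlgebra.coeff_single_mul_eq_mul_coeff (τ⁻¹ * η)
    (fun x _ => by rw [eq_inv_mul_iff_mul_eq]), one_mul, MonoidAlgebra.coeff_smul_apply]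
  have := coeff_charIdem_mul_translate ψ 1 η (σ := τ⁻¹) (by rw [inv_pow, hτ, inv_one])
  simpa using this

lemma charIdem_mul_charIdem [CharZero Ω] [DecidableEq (charTorsion N Ω m)]
    (hpm : Nat.Coprime (p ^ a) m)
    (hN : ∀ η : N, η ^ (p ^ a * m) = 1) (hcard : Nat.card (torsionPart N m) = m) (hm : m ≠ 0)
    (ψ χ : charTorsion N Ω m) :
    charIdem ψ * charIdem χ = if ψ = χ then charIdem χ else 0 := by
  classical
  conv_lhs => rw [charIdem_eq ψ]
  rw [smul_mul_assoc, Finset.sum_mul]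
  have : ∀ τ : torsionPart N m, MonoidAlgebra.single (τ : N) ((ψ.1 τ⁻¹ : Ωˣ) : Ω) * charIdem χ =
      (((ψ.1 τ⁻¹ : Ωˣ) : Ω) * ((χ.1 τ : Ωˣ) : Ω)) • charIdem χ := by
    intro τ
    rw [mul_smul, ← single_mul_charIdem χ τ.2, ← smul_mul_assoc, MonoidAlgebra.smul_single,
      smul_eq_mul, mul_one]
  rw [Finset.sum_congr rfl fun τ _ => this τ, ← Finset.sum_smul,
    sum_char_mul_char hpm hN hcard, smul_smul]
  split_ifs
  · rw [inv_mul_cancel₀ (by exact_mod_cast hm), one_smul]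
  · simp

/-- Characters of order dividing `m` separate `N[m]`, so all coefficients of the sum away from the
identity vanish. The remaining scalar is found by evaluating at the trivial character, which avoids
counting characters. -/
lemma sum_charIdem [CharZero Ω] [IsAlgClosed Ω] [Fintype (charTorsion N Ω m)]
    (hpm : Nat.Coprime (p ^ a) m)
    (hN : ∀ η : N, η ^ (p ^ a * m) = 1) (hcard : Nat.card (torsionPart N m) = m) (hm : m ≠ 0) :
    ∑ ψ : charTorsion N Ω m, charIdem ψ = 1 := by
  classical
  have hzero : ∀ τ : N, τ ^ m = 1 → τ ≠ 1 →
      ∑ ψ : charTorsion N Ω m, ((ψ.1 τ⁻¹ : Ωˣ) : Ω) = 0 := by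
    intro τ hτ hne
    have : NeZero (Monoid.exponent N) := ⟨Monoid.exponent_ne_zero_of_finite⟩
    obtain ⟨φ, hφ⟩ := CommGroup.exists_apply_ne_one_of_hasEnoughRootsOfUnity N Ω
      (inv_ne_one.2 hne)
    have hφm : (φ τ⁻¹) ^ m = 1 := by rw [← map_pow, inv_pow, hτ, inv_one, map_one]
    let f : charTorsion N Ω m →* Ω :=
      { toFun := fun ψ => ((ψ.1 τ⁻¹ : Ωˣ) : Ω)
        map_one' := by simp
        map_mul' := fun _ _ => by simp }
    refine sum_hom_units_eq_zero f ?_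
    intro hf
    -- The power `p ^ a` makes the order of the character divide `m`; its value at the `m`-torsion
    -- element stays nontrivial since `p ^ a` is prime to `m`.
    let χ : charTorsion N Ω m := ⟨φ ^ p ^ a, by
      rw [MonoidHom.mem_ker]
      ext η
      simp [← pow_mul, ← map_pow, hN]⟩
    have h1 : (φ τ⁻¹) ^ p ^ a = 1 := by
      have := DFunLike.congr_fun hf χ
      ext
      simpa [f, χ] using this
    apply hφ
    rw [← orderOf_eq_one_iff, ← Nat.dvd_one, ← hpm.gcd_eq_one]
    exact Nat.dvd_gcd (orderOf_dvd_iff_pow_eq_one.2 h1) (orderOf_dvd_iff_pow_eq_one.2 hφm)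
  have hsum : ∑ ψ : charTorsion N Ω m, charIdem ψ =
      ((m : Ω)⁻¹ * Fintype.card (charTorsion N Ω m)) • (1 : MonoidAlgebra Ω N) := by
    refine ext_coeff fun η => ?_
    rw [MonoidAlgebra.coeff_sum, Finsupp.finsetSum_apply]
    simp only [coeff_charIdem]
    rw [MonoidAlgebra.coeff_smul_apply, MonoidAlgebra.one_def, MonoidAlgebra.coeff_single,
      Finsupp.single_apply]
    split_ifs with h1 h2 h2
    · subst h2
      simp [mul_comm]
    · rw [← Finset.mul_sum, hzero η h1 (Ne.symm h2)]
      simp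
    · subst h2
      simp at h1
    · simp
  have h1 : charEval ((1 : charTorsion N Ω m)).1 (∑ ψ : charTorsion N Ω m, charIdem ψ) = 1 := by
    rw [map_sum, Finset.sum_congr rfl fun χ _ => charEval_charIdem hpm hN hcard hm 1 χ]
    simp
  rw [hsum, map_smul, map_one, smul_eq_mul, mul_one] at h1
  rw [hsum, h1, one_smul]

end

end Idempotents

end

/-! ### Twisted Galois action on characters and group algebras -/

section

section Twist

variable {N Ω Γ : Type*} [CommGroup N] [Field Ω] [Group Γ] {m : ℕ}
  (gal : Γ →* RingAut Ω) (cj : Γ →* MulAut N)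

/-- The action of `γ` on the characters of `N` induced by actions on `Ω` and on `N`. -/
def twistChar (γ : Γ) (ψ : charTorsion N Ω m) : charTorsion N Ω m :=
  ⟨(Units.map (gal γ : Ω →* Ω)).comp (ψ.1.comp (cj γ⁻¹).toMonoidHom), by
    rw [MonoidHom.mem_ker]
    ext η
    have := congrArg Units.val (charTorsion_pow ψ (cj γ⁻¹ η))
    simpa [← map_pow] using congrArg (gal γ) this⟩

lemma twistChar_apply (γ : Γ) (ψ : charTorsion N Ω m) (η : N) :
    (((twistChar gal cj γ ψ).1 (cj γ η) : Ωˣ) : Ω) = gal γ ((ψ.1 η : Ωˣ) : Ω) := by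
  change gal γ ((ψ.1 (cj γ⁻¹ (cj γ η)) : Ωˣ) : Ω) = _
  rw [← MulAut.mul_apply, ← map_mul, inv_mul_cancel, map_one, MulAut.one_apply]

/-- The action of a group on characters induced by actions on `Ω` and on `N`. -/
abbrev twistAction : MulAction Γ (charTorsion N Ω m) where
  smul := twistChar gal cj
  one_smul ψ := by
    change twistChar gal cj 1 ψ = ψ
    refine Subtype.ext (MonoidHom.ext fun η => Units.ext ?_)
    have := twistChar_apply gal cj 1 ψ η
    simpa using this
  mul_smul γ δ ψ := by
    change twistChar gal cj (γ * δ) ψ = twistChar gal cj γ (twistChar gal cj δ ψ)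
    refine Subtype.ext (MonoidHom.ext fun η => Units.ext ?_)
    obtain ⟨ν, rfl⟩ : ∃ ν, η = cj γ (cj δ ν) :=
      ⟨(cj δ).symm ((cj γ).symm η), by simp⟩
    rw [twistChar_apply, twistChar_apply]
    have := twistChar_apply gal cj (γ * δ) ψ ν
    simpa using this

/-- Two characters are equivalent if they are in the same orbit. -/
def twistSetoid (m : ℕ) : Setoid (charTorsion N Ω m) :=
  @MulAction.orbitRel Γ (charTorsion N Ω m) _ (twistAction gal cj)

lemma twistSetoid_mk_twistChar (γ : Γ) (ψ : charTorsion N Ω m) :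
    Quotient.mk (twistSetoid gal cj m) (twistChar gal cj γ ψ) = Quotient.mk _ ψ :=
  Quotient.sound ⟨γ, rfl⟩

lemma exists_twistChar_eq_out (ψ : charTorsion N Ω m) :
    ∃ γ, twistChar gal cj γ ψ = (Quotient.mk (twistSetoid gal cj m) ψ).out := by
  obtain ⟨γ, hγ⟩ := Quotient.exact (Quotient.out_eq (Quotient.mk (twistSetoid gal cj m) ψ))
  exact ⟨γ, hγ⟩

/-- Elements of `Ω[N]` invariant under simultaneous actions on `Ω` and on `N`. -/
def IsTwistInvariant (z : MonoidAlgebra Ω N) : Prop :=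
  ∀ (γ : Γ) (η : N), z.coeff (cj γ η) = gal γ (z.coeff η)

variable {gal cj}

variable [Fintype N]

lemma coeff_charIdem_twist (γ : Γ) (ψ : charTorsion N Ω m) (η : N) :
    (charIdem (twistChar gal cj γ ψ)).coeff (cj γ η) = gal γ ((charIdem ψ).coeff η) := by
  classical
  rw [coeff_charIdem, coeff_charIdem, ← map_pow, ← map_inv, twistChar_apply]
  simp only [EmbeddingLike.map_eq_one_iff]
  split_ifs <;> simp

lemma isTwistInvariant_sum_charIdem [Fintype (charTorsion N Ω m)]
    (O : charTorsion N Ω m → Prop) [DecidablePred O] (hO : ∀ γ ψ, O ψ → O (twistChar gal cj γ ψ)) :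
    IsTwistInvariant gal cj (∑ ψ with O ψ, charIdem ψ) := by
  let := twistAction (m := m) gal cj
  intro γ η
  rw [MonoidAlgebra.coeff_sum, Finsupp.finsetSum_apply, Finsupp.finsetSum_apply, map_sum]
  symm
  refine Finset.sum_equiv (MulAction.toPerm γ) (fun ψ => ?_) (fun ψ _ => ?_)
  · simp only [Finset.mem_filter, Finset.mem_univ, true_and, MulAction.toPerm_apply]
    refine ⟨hO γ ψ, fun h => ?_⟩
    have := hO γ⁻¹ _ h
    change O (γ⁻¹ • γ • ψ) at this
    rwa [inv_smul_smul] at this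
  · exact (coeff_charIdem_twist γ ψ η).symm

variable {v : Valuation Ω NNReal}

/-- Conjugating `ψ(z)` reproduces the twisted character's value up to its value at `ρ`, a root of
unity. The shift by `ρ` is needed because `γ` moves the base point `1̄`. -/
lemma valuation_charEval_twist (hv : ∀ γ x, v (gal γ x) = v x) (hm : m ≠ 0)
    {z : MonoidAlgebra Ω N} {γ : Γ} {ρ : N}
    (hz : ∀ ν, gal γ (z.coeff ν) = z.coeff (cj γ ν * ρ)) (ψ : charTorsion N Ω m) :
    v (charEval (twistChar gal cj γ ψ).1 z) = v (charEval ψ.1 z) := by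
  rw [← hv γ (charEval ψ.1 z), charEval_apply, charEval_apply, map_sum (gal γ)]
  have h1 : ∑ η, z.coeff η * (((twistChar gal cj γ ψ).1 η : Ωˣ) : Ω) =
      (((twistChar gal cj γ ψ).1 ρ : Ωˣ) : Ω) * ∑ ν, gal γ (z.coeff ν * ((ψ.1 ν : Ωˣ) : Ω)) := by
    rw [Finset.mul_sum]
    symm
    refine Fintype.sum_equiv ((cj γ).toEquiv.trans (Equiv.mulRight ρ)) _ _ fun ν => ?_
    rw [map_mul, hz, ← twistChar_apply (cj := cj)]
    change _ = z.coeff (cj γ ν * ρ) * (((twistChar gal cj γ ψ).1 (cj γ ν * ρ) : Ωˣ) : Ω)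
    rw [map_mul (twistChar gal cj γ ψ).1, Units.val_mul]
    ring
  rw [h1, map_mul, valuation_char _ hm, one_mul]

/-- `t` and `x` transform with the same shift `ρ`, so every conjugate of `z` also solves `z * t =
x`; cancel the unit `t`. -/
lemma isTwistInvariant_of_mul_eq {z t x : MonoidAlgebra Ω N} (ht : IsUnit t) (h : z * t = x)
    (hc : ∀ γ, ∃ ρ : N, (∀ ν, gal γ (t.coeff ν) = t.coeff (cj γ ν * ρ)) ∧
      ∀ ν, gal γ (x.coeff ν) = x.coeff (cj γ ν * ρ)) :
    IsTwistInvariant gal cj z := by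
  intro γ η
  obtain ⟨ρ, h1, h2⟩ := hc γ
  let z' : MonoidAlgebra Ω N := ofFun Ω fun η => gal γ (z.coeff ((cj γ).symm η))
  have hz' : z' * t = x := by
    refine ext_coeff fun μ => ?_
    obtain ⟨ν, rfl⟩ : ∃ ν, μ = cj γ ν * ρ := ⟨(cj γ).symm (μ * ρ⁻¹), by simp⟩
    rw [← h2, ← h, coeff_mul_eq_sum, coeff_mul_eq_sum, map_sum]
    symm
    refine Fintype.sum_equiv (cj γ).toEquiv _ _ fun η => ?_
    change _ = z'.coeff (cj γ η) * _
    rw [map_mul, h1]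
    simp [z', mul_assoc]
  have : z' = z := ht.mul_right_cancel (hz'.trans h.symm)
  conv_lhs => rw [← this]
  simp [z']

end Twist

/-! ### Gluing local generators -/

section Core

variable {N Ω Γ V : Type*} [CommGroup N] [Finite N] [Field Ω] [CharZero Ω] [IsAlgClosed Ω]
  [Group Γ] [AddCommGroup V] {p a m : ℕ} {v : Valuation Ω NNReal}
  {gal : Γ →* RingAut Ω} {cj : Γ →* MulAut N}

/-- A lattice `B` such that each component for a character of order prime to `p` is generated by
one element has a generator over the invariant elements of the integral group ring. -/
theorem exists_generator (hp : p.Prime) (hvp : v p < 1) (hvm : v m = 1)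
    (hpm : Nat.Coprime (p ^ a) m)
    (hN : ∀ η : N, η ^ (p ^ a * m) = 1) (hcard : Nat.card (torsionPart N m) = m)
    (hv : ∀ γ x, v (gal γ x) = v x)
    (φ : V →+ MonoidAlgebra Ω N) (B : AddSubgroup V)
    (hφ : ∀ γ, ∃ ρ : N, ∀ x ν, gal γ ((φ x).coeff ν) = (φ x).coeff (cj γ ν * ρ))
    (hB : ∀ z : MonoidAlgebra Ω N, (∀ η, v (z.coeff η) ≤ 1) → IsTwistInvariant gal cj z →
      ∀ x ∈ B, ∃ y ∈ B, φ y = z * φ x)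
    (hgen : ∀ ψ : charTorsion N Ω m, ∃ x ∈ B, charEval ψ.1 (φ x) ≠ 0 ∧
      ∀ x' ∈ B, ∀ η, v ((charIdem ψ * φ x').coeff η) ≤ v (charEval ψ.1 (φ x))) :
    ∃ t ∈ B, IsUnit (φ t) ∧ ∀ x ∈ B, ∃ w : MonoidAlgebra Ω N,
      (∀ η, v (w.coeff η) ≤ 1) ∧ IsTwistInvariant gal cj w ∧ w * φ t = φ x := by
  classical
  have := Fintype.ofFinite N
  have := Fintype.ofFinite (charTorsion N Ω m)
  have hm : m ≠ 0 := by
    rintro rfl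
    simp at hvm
  let r := twistSetoid gal cj m
  choose gx hgB hg0 hgle using hgen
  -- A single `e_ψ` need not be invariant, but the sum over a Galois orbit is, so it preserves `B`.
  let e : Quotient r → MonoidAlgebra Ω N := fun o => ∑ ψ with Quotient.mk r ψ = o, charIdem ψ
  have hmk : ∀ (γ : Γ) (ψ : charTorsion N Ω m),
      Quotient.mk r (twistChar gal cj γ ψ) = Quotient.mk r ψ :=
    twistSetoid_mk_twistChar gal cj
  have he : ∀ o, IsTwistInvariant gal cj (e o) := fun o =>
    isTwistInvariant_sum_charIdem (fun ψ => Quotient.mk r ψ = o) fun γ ψ h => (hmk γ ψ).trans h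
  have hev : ∀ o η, v ((e o).coeff η) ≤ 1 := by
    intro o η
    rw [MonoidAlgebra.coeff_sum, Finsupp.finsetSum_apply]
    exact v.map_sum_le fun ψ _ => valuation_charIdem_le hvm ψ η
  have hce : ∀ o ψ, charEval ψ.1 (e o) = if Quotient.mk r ψ = o then 1 else 0 := by
    intro o ψ
    rw [map_sum, Finset.sum_congr rfl fun χ _ => charEval_charIdem hpm hN hcard hm ψ χ,
      Finset.sum_ite_eq']
    simp
  -- One generator per orbit, taken at the chosen representative and projected to that orbit's
  -- component.
  choose y hyB hy using fun o => hB (e o) (hev o) (he o) (gx o.out) (hgB o.out)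
  have hinv : ∀ (γ : Γ) (ψ : charTorsion N Ω m) (x : V),
      v (charEval (twistChar gal cj γ ψ).1 (φ x)) = v (charEval ψ.1 (φ x)) := by
    intro γ ψ x
    obtain ⟨ρ, hρ⟩ := hφ γ
    exact valuation_charEval_twist hv hm (hρ x) ψ
  have hinv' : ∀ (ψ : charTorsion N Ω m) (x : V),
      v (charEval (Quotient.mk r ψ).out.1 (φ x)) = v (charEval ψ.1 (φ x)) := by
    intro ψ x
    obtain ⟨γ, hγ⟩ := exists_twistChar_eq_out gal cj ψ
    rw [← hγ]
    exact hinv γ ψ x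
  let t : V := ∑ o, y o
  have ht : ∀ ψ : charTorsion N Ω m,
      charEval ψ.1 (φ t) = charEval ψ.1 (φ (gx (Quotient.mk r ψ).out)) := by
    intro ψ
    simp only [t, map_sum, hy, map_mul, hce]
    simp
  have hvt : ∀ ψ : charTorsion N Ω m, v (charEval ψ.1 (φ t)) ≠ 0 := by
    intro ψ
    rw [ht, ← hinv', v.ne_zero_iff]
    exact hg0 _
  have hbound : ∀ (ψ : charTorsion N Ω m), ∀ x ∈ B, ∀ η,
      v ((charIdem ψ * φ x).coeff η) ≤ v (charEval ψ.1 (φ t)) := by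
    intro ψ x hx η
    -- The generator for `ψ` itself bounds the `ψ`-component. Both values are moved to the orbit
    -- representative `χ`, where the generator used in `t` dominates every element of `B`.
    refine (hgle ψ x hx η).trans ?_
    rw [ht, ← hinv' ψ, ← hinv' ψ]
    set χ := (Quotient.mk r ψ).out
    have := valuation_charEval_le hm χ (hgle χ (gx ψ) (hgB ψ))
    rw [map_mul, charEval_charIdem hpm hN hcard hm, if_pos rfl, one_mul] at this
    exact this
  let c : charTorsion N Ω m → Ω := fun ψ => charEval ψ.1 (φ t)
  have hc : ∀ ψ, c ψ ≠ 0 := fun ψ => v.ne_zero_iff.1 (hvt ψ)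
  -- `D` rescales each component by the value of `t`, so `D * φ x` is integral for all `x ∈ B` while
  -- `D * φ t` has value `1` at every `ψ`, hence is an integral unit.
  let D : MonoidAlgebra Ω N := ∑ ψ, (c ψ)⁻¹ • charIdem ψ
  let C : MonoidAlgebra Ω N := ∑ ψ, c ψ • charIdem ψ
  have hCD : C * D = 1 := by
    simp only [C, D]
    rw [Finset.sum_mul_sum, ← sum_charIdem hpm hN hcard hm]
    refine Finset.sum_congr rfl fun ψ _ => ?_
    simp only [smul_mul_smul_comm, charIdem_mul_charIdem hpm hN hcard hm]
    simp [hc]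
  have hDint : ∀ x ∈ B, ∀ η, v ((D * φ x).coeff η) ≤ 1 := by
    intro x hx η
    simp only [D]
    rw [Finset.sum_mul, MonoidAlgebra.coeff_sum, Finsupp.finsetSum_apply]
    refine v.map_sum_le fun ψ _ => ?_
    rw [smul_mul_assoc, MonoidAlgebra.coeff_smul_apply, smul_eq_mul, map_mul, map_inv₀]
    exact (mul_le_mul_right (hbound ψ x hx η) _).trans_eq (inv_mul_cancel₀ (hvt ψ))
  have hDchar : ∀ ψ : charTorsion N Ω m, charEval ψ.1 D = (c ψ)⁻¹ := by
    intro ψ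
    simp only [D]
    rw [map_sum]
    simp only [map_smul, charEval_charIdem hpm hN hcard hm ψ]
    simp
  have htB : t ∈ B := sum_mem fun o _ => hyB o
  obtain ⟨u, hu, hu1⟩ := exists_integral_inverse v hp hvp hvm hN (hDint t htB) (fun ψ => by
    rw [map_mul, hDchar, inv_mul_cancel₀ (hc ψ), map_one])
  have htu : IsUnit (φ t) := IsUnit.of_mul_eq_one (D * u) (by rw [← hu1]; ring)
  refine ⟨t, htB, htu, fun x hx => ?_⟩
  have hw : (D * φ x * u) * φ t = φ x := by
    calc (D * φ x * u) * φ t = φ x * (D * φ t * u) := by ring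
      _ = φ x := by rw [hu1, mul_one]
  refine ⟨D * φ x * u, fun η => ?_, ?_, hw⟩
  · rw [mul_comm]
    exact valuation_coeff_mul_le v hu (hDint x hx) η
  · refine isTwistInvariant_of_mul_eq htu hw fun γ => ?_
    obtain ⟨ρ, hρ⟩ := hφ γ
    exact ⟨ρ, hρ t, hρ x⟩

end Core

end

/-! ### Local generators from independence of reduced characters -/

section

/-- By the ultrametric inequality the maximum over a finite generating set bounds the whole module.
The element `0` is inserted so that the finite set is nonempty. -/
lemma exists_max_valuation_of_fg {S V Ω N : Type*} [CommRing S] [AddCommGroup V] [Module S V]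
    [Field Ω] [Finite N] [Nonempty N] {v : Valuation Ω NNReal} (f : V →+ (N → Ω))
    (hf : ∀ (s : S) (x : V) (η : N), v (f (s • x) η) ≤ v (f x η)) {B : Submodule S V} (hB : B.FG) :
    ∃ x₀ ∈ B, ∃ η₀, ∀ x ∈ B, ∀ η, v (f x η) ≤ v (f x₀ η₀) := by
  classical
  have := Fintype.ofFinite N
  obtain ⟨T, rfl⟩ := hB
  obtain ⟨⟨x₀, η₀⟩, hmem, hmax⟩ := Finset.exists_max_image ((insert 0 T) ×ˢ Finset.univ)
    (fun q : V × N => v (f q.1 q.2)) ⟨(0, Classical.arbitrary N), by simp⟩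
  have hx₀ : x₀ ∈ Submodule.span S (T : Set V) := by
    simp only [Finset.mem_product, Finset.mem_insert, Finset.mem_univ, and_true] at hmem
    rcases hmem with rfl | h
    · exact zero_mem _
    · exact Submodule.subset_span h
  refine ⟨x₀, hx₀, η₀, fun x hx η => ?_⟩
  induction hx using Submodule.span_induction with
  | mem x h => exact hmax (x, η) (by simp [Finset.mem_coe.1 h])
  | zero => simp
  | add x y _ _ hx hy =>
    rw [map_add]
    exact v.map_add_le hx hy
  | smul s x _ hx => exact (hf s x η).trans hx

variable {N Ω V : Type*} [CommGroup N] [Field Ω] {m : ℕ}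

/-- Independence of the reductions of characters: a sum with integral coefficients, one of them a
unit, is a unit at some argument. -/
lemma exists_valuation_sum_eq_one [Fintype N] {v : Valuation Ω NNReal} (hvm : v m = 1)
    (hcard : Nat.card (torsionPart N m) = m) {O : Type*} [Monoid O] (c : N → O →* Ω)
    (hcv : ∀ η a, v (c η a) ≤ 1) (hc : ∀ η τ : N, τ ^ m = 1 → c (τ * η) = c η)
    (hc' : ∀ η ν : N, (∀ a, v (c η a - c ν a) < 1) → (ν / η) ^ m = 1)
    (f : N → Ω) (hf : ∀ η, v (f η) ≤ 1) (hfc : ∀ η τ : N, τ ^ m = 1 → f (τ * η) = f η)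
    {η₀ : N} (hη₀ : v (f η₀) = 1) :
    ∃ a, v (∑ η, f η * c η a) = 1 := by
  classical
  by_contra hcon
  push Not at hcon
  let R := v.valuationSubring
  let k := IsLocalRing.ResidueField R
  let red : R →+* k := IsLocalRing.residue R
  have hred : ∀ x : R, red x = 0 ↔ v (x : Ω) < 1 := by
    intro x
    rw [IsLocalRing.residue_eq_zero_iff, IsLocalRing.mem_maximalIdeal, mem_nonunits_iff,
      valuationSubring_isUnit_iff]
    exact ⟨fun h => lt_of_le_of_ne ((v.mem_valuationSubring_iff _).1 x.2) h, fun h => h.ne⟩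
  let cR : N → O →* R := fun η =>
    { toFun := fun a => ⟨c η a, (v.mem_valuationSubring_iff _).2 (hcv η a)⟩
      map_one' := Subtype.ext (by simp)
      map_mul' := fun a b => Subtype.ext (by simp) }
  let ck : N → O →* k := fun η => (red : R →* k).comp (cR η)
  let fR : N → R := fun η => ⟨f η, (v.mem_valuationSubring_iff _).2 (hf η)⟩
  have hck : ∀ η ν, ck η = ck ν ↔ (η / ν) ^ m = 1 := by
    intro η ν
    constructor
    · intro h
      refine hc' ν η fun a => ?_
      have h1 : red (cR ν a) = red (cR η a) := (DFunLike.congr_fun h a).symm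
      rw [← sub_eq_zero, ← map_sub, hred] at h1
      exact h1
    · intro h
      have : c η = c ν := by
        rw [← hc ν _ h, div_mul_cancel]
      ext a
      change red (cR η a) = red (cR ν a)
      congr 1
      exact Subtype.ext (DFunLike.congr_fun this a)
  have hsum : ∀ a, ∑ η, red (fR η) * ck η a = 0 := by
    intro a
    have h1 : v (∑ η, f η * c η a) < 1 := by
      refine lt_of_le_of_ne (v.map_sum_le fun η _ => ?_) (hcon a)
      rw [map_mul]
      exact mul_le_one' (hf η) (hcv η a)
    have h2 : red (∑ η, fR η * cR η a) = 0 := by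
      rw [hred]
      push_cast
      exact h1
    rw [map_sum] at h2
    simp only [map_mul] at h2
    exact h2
  -- If every sum were a nonunit, reduction would give a relation among the characters `ck η`. Equal
  -- ones are collected first, since Dedekind's theorem concerns distinct characters.
  have hli := linearIndependent_iff'.1 (linearIndependent_monoidHom O k)
    (Finset.univ.image ck) (fun χ => ∑ η with ck η = χ, red (fR η)) (by
      ext a
      rw [Finset.sum_apply, Pi.zero_apply, ← hsum a]
      simp only [Pi.smul_apply, smul_eq_mul, Finset.sum_mul]
      rw [← Finset.sum_fiberwise_of_maps_to (s := Finset.univ) (t := Finset.univ.image ck) (g := ck)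
        (fun η _ => Finset.mem_image_of_mem _ (Finset.mem_univ η))]
      refine Finset.sum_congr rfl fun χ _ => Finset.sum_congr rfl fun η hη => ?_
      rw [(Finset.mem_filter.1 hη).2])
    (ck η₀) (Finset.mem_image_of_mem _ (Finset.mem_univ η₀))
  -- The fibre through `η₀` is its `N[m]`-coset, on which `f` is constant; the collected coefficient
  -- is therefore `m` times a unit.
  have h3 : ∑ η with ck η = ck η₀, red (fR η) = ∑ τ : torsionPart N m, red (fR η₀) := by
    symm
    refine Finset.sum_bij (fun τ _ => (τ : N) * η₀) ?_ ?_ ?_ ?_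
    · intro τ _
      rw [Finset.mem_filter, hck]
      exact ⟨Finset.mem_univ _, by rw [mul_div_cancel_right]; exact τ.2⟩
    · intro τ _ σ _ h
      exact Subtype.ext (mul_right_cancel h)
    · intro η hη
      rw [Finset.mem_filter, hck] at hη
      exact ⟨⟨η / η₀, hη.2⟩, Finset.mem_univ _, div_mul_cancel _ _⟩
    · intro τ _
      congr 1
      exact Subtype.ext (hfc η₀ τ τ.2).symm
  rw [h3, Finset.sum_const, Finset.card_univ, ← Nat.card_eq_fintype_card, hcard, nsmul_eq_mul,
    mul_eq_zero] at hli
  rcases hli with h | h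
  · have : red (m : R) = 0 := by simpa using h
    rw [hred] at this
    simp [hvm] at this
  · rw [hred] at h
    exact h.ne hη₀

variable {p a : ℕ}

/-- The component of a lattice for a character of order `m`, `p ∤ m`, is generated by one element
if the lattice is stable under sufficiently many characters which separate cosets of the
`m`-torsion part modulo the maximal ideal. -/
lemma exists_charEval_max [Fintype N] [CharZero Ω] {v : Valuation Ω NNReal} (hvm : v m = 1)
    (hpm : Nat.Coprime (p ^ a) m)
    (hN : ∀ η : N, η ^ (p ^ a * m) = 1)
    (hcard : Nat.card (torsionPart N m) = m) {O : Type*} [Monoid O] (c : N → O →* Ω)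
    (hcv : ∀ η a, v (c η a) ≤ 1) (hc : ∀ η τ : N, τ ^ m = 1 → c (τ * η) = c η)
    (hc' : ∀ η ν : N, (∀ a, v (c η a - c ν a) < 1) → (ν / η) ^ m = 1)
    (φ : V → MonoidAlgebra Ω N) (B : Set V)
    (hB : ∀ (r : O), ∀ x ∈ B, ∃ y ∈ B, ∀ η, (φ y).coeff η = c η r * (φ x).coeff η)
    (ψ : charTorsion N Ω m) {x₀ : V} (hx₀ : x₀ ∈ B) {η₀ : N}
    (hne : (charIdem ψ * φ x₀).coeff η₀ ≠ 0)
    (hmax : ∀ x ∈ B, ∀ η,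
      v ((charIdem ψ * φ x).coeff η) ≤ v ((charIdem ψ * φ x₀).coeff η₀)) :
    ∃ x ∈ B, charEval ψ.1 (φ x) ≠ 0 ∧
      ∀ x' ∈ B, ∀ η, v ((charIdem ψ * φ x').coeff η) ≤ v (charEval ψ.1 (φ x)) := by
  classical
  have hm : m ≠ 0 := by
    rintro rfl
    simp at hvm
  set M := (charIdem ψ * φ x₀).coeff η₀
  have hvM : v M ≠ 0 := v.ne_zero_iff.2 hne
  -- After division by the maximal coefficient `M`, the terms of `ψ(e_ψ φ x₀)` are integral,
  -- constant on `N[m]`-cosets, and of value `1` at `η₀`.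
  obtain ⟨r, hr⟩ := exists_valuation_sum_eq_one hvm hcard c hcv hc hc'
    (fun η => M⁻¹ * ((charIdem ψ * φ x₀).coeff η * ((ψ.1 η : Ωˣ) : Ω)))
    (fun η => by
      rw [map_mul, map_mul, map_inv₀, valuation_char ψ hm, mul_one]
      exact (mul_le_mul_right (hmax x₀ hx₀ η) _).trans_eq (inv_mul_cancel₀ hvM))
    (fun η τ hτ => by
      rw [coeff_charIdem_mul_translate ψ _ _ hτ, map_mul, map_inv, Units.val_mul]
      rw [Units.val_inv_eq_inv_val]
      field_simp)
    (η₀ := η₀) (by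
      rw [map_mul, map_mul, map_inv₀, valuation_char ψ hm, mul_one, inv_mul_cancel₀ hvM])
  obtain ⟨y, hyB, hy⟩ := hB r x₀ hx₀
  have hey : ∀ η, (charIdem ψ * φ y).coeff η = c η r * (charIdem ψ * φ x₀).coeff η := by
    intro η
    rw [coeff_charIdem_mul, coeff_charIdem_mul, mul_left_comm, Finset.mul_sum (a := c η r)]
    congr 1
    refine Finset.sum_congr rfl fun τ _ => ?_
    rw [hy, hc η (τ : N)⁻¹ (by rw [inv_pow, inv_eq_one]; exact τ.2)]
    ring
  have hval : v (charEval ψ.1 (φ y)) = v M := by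
    have h1 : charEval ψ.1 (φ y) = charEval ψ.1 (charIdem ψ * φ y) := by
      rw [map_mul, charEval_charIdem hpm hN hcard hm, if_pos rfl, one_mul]
    have h2 : charEval ψ.1 (φ y) =
        M * ∑ η, M⁻¹ * ((charIdem ψ * φ x₀).coeff η * ((ψ.1 η : Ωˣ) : Ω)) * c η r := by
      rw [h1, charEval_apply, Finset.mul_sum]
      refine Finset.sum_congr rfl fun η _ => ?_
      rw [hey]
      field_simp
    rw [h2, map_mul, hr, mul_one]
  refine ⟨y, hyB, ?_, fun x' hx' η => ?_⟩
  · rw [← v.ne_zero_iff, hval]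
    exact hvM
  · rw [hval]
    exact hmax x' hx' η

end

section

/-! ## Valuations on algebraic extensions of `ℚ_p` -/

section Valuation

variable (p : ℕ) [Fact p.Prime] (Ω : Type*) [Field Ω] [Algebra ℚ_[p] Ω]
  [Algebra.IsAlgebraic ℚ_[p] Ω]

/-- The valuation on an algebraic extension of `ℚ_p` defined by the spectral norm. -/
def spectralValuation : Valuation Ω NNReal :=
  let := spectralNorm.normedField ℚ_[p] Ω
  haveI : IsUltrametricDist Ω :=
    IsUltrametricDist.isUltrametricDist_of_isNonarchimedean_norm
      (isNonarchimedean_spectralNorm (K := ℚ_[p]) (L := Ω))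
  NormedField.valuation

variable {Ω}

lemma coe_spectralValuation (x : Ω) :
    (spectralValuation p Ω x : ℝ) = spectralNorm ℚ_[p] Ω x := rfl

lemma spectralValuation_algEquiv (σ : Gal(Ω/ℚ_[p])) (x : Ω) :
    spectralValuation p Ω (σ x) = spectralValuation p Ω x := by
  apply NNReal.coe_injective
  rw [coe_spectralValuation, coe_spectralValuation]
  exact (spectralNorm_eq_of_equiv σ x).symm

lemma spectralValuation_algebraMap (x : ℚ_[p]) :
    (spectralValuation p Ω (algebraMap _ _ x) : ℝ) = ‖x‖ := by
  rw [coe_spectralValuation, spectralNorm_extends]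

variable (Ω) in
lemma spectralValuation_p_lt_one : spectralValuation p Ω p < 1 := by
  rw [← NNReal.coe_lt_coe, ← map_natCast (algebraMap ℚ_[p] Ω), spectralValuation_algebraMap]
  exact Padic.norm_p_lt_one

variable (Ω) in
lemma spectralValuation_natCast_eq_one {m : ℕ} (h : p.Coprime m) :
    spectralValuation p Ω m = 1 := by
  rw [← NNReal.coe_inj, ← map_natCast (algebraMap ℚ_[p] Ω), spectralValuation_algebraMap]
  exact Padic.norm_natCast_eq_one_iff.2 h

/-- Valuation rings are integrally closed, which gives one direction. Conversely, spectral value at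
most `1` says that the minimal polynomial over `ℚ_[p]` has coefficients in `ℤ_p`. -/
lemma isIntegral_iff_spectralValuation_le_one (x : Ω) :
    IsIntegral (PadicInt.subring p) x ↔ spectralValuation p Ω x ≤ 1 := by
  set v := spectralValuation p Ω
  constructor
  · intro hx
    let f : PadicInt.subring p →+* v.valuationSubring :=
      ((algebraMap ℚ_[p] Ω).comp (PadicInt.subring p).subtype).codRestrict
        v.valuationSubring.toSubring (fun y => by
          refine (v.mem_valuationSubring_iff _).2 ?_
          rw [← NNReal.coe_le_coe]
          exact (spectralValuation_algebraMap p (y : ℚ_[p])).trans_le y.2)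
    obtain ⟨P, hP, hPx⟩ := hx
    have hint : IsIntegral v.valuationSubring x := by
      refine ⟨P.map f, hP.map f, ?_⟩
      rw [Polynomial.eval₂_map]
      exact hPx
    obtain ⟨y, rfl⟩ := (IsIntegrallyClosed.isIntegral_iff (R := v.valuationSubring)).1 hint
    exact (v.mem_valuationSubring_iff _).1 y.2
  · intro hx
    have hint : IsIntegral ℚ_[p] x := Algebra.IsIntegral.isIntegral x
    have h1 : spectralValue (minpoly ℚ_[p] x) ≤ 1 := by
      have : (v x : ℝ) ≤ 1 := by exact_mod_cast hx
      exact this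
    rw [spectralValue_le_one_iff (minpoly.monic hint)] at h1
    have hlift : minpoly ℚ_[p] x ∈ Polynomial.lifts (PadicInt.subring p).subtype := by
      rw [Polynomial.lifts_iff_coeff_lifts]
      exact fun n => ⟨⟨_, h1 n⟩, rfl⟩
    obtain ⟨P, hP, -, hPm⟩ := Polynomial.lifts_and_natDegree_eq_and_monic hlift (minpoly.monic hint)
    refine ⟨P, hPm, ?_⟩
    have : (algebraMap (PadicInt.subring p) Ω) =
      (algebraMap ℚ_[p] Ω).comp (PadicInt.subring p).subtype := rfl
    rw [this, ← Polynomial.eval₂_map, hP]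
    exact minpoly.aeval ℚ_[p] x

variable {K : Type*} [Field K] [Algebra ℚ_[p] K] [Algebra K Ω] [IsScalarTower ℚ_[p] K Ω]

lemma isIntegral_padicIntegers_iff (x : Ω) :
    IsIntegral (padicIntegers p K) x ↔ spectralValuation p Ω x ≤ 1 := by
  let : Algebra (PadicInt.subring p) (padicIntegers p K) :=
    inferInstanceAs (Algebra (PadicInt.subring p) (integralClosure (PadicInt.subring p) K))
  have h1 : Algebra.IsIntegral (PadicInt.subring p) (padicIntegers p K) :=
    inferInstanceAs (Algebra.IsIntegral (PadicInt.subring p)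
      (integralClosure (PadicInt.subring p) K))
  have : IsScalarTower (PadicInt.subring p) (padicIntegers p K) Ω := by
    refine IsScalarTower.of_algebraMap_eq fun r => ?_
    exact IsScalarTower.algebraMap_apply ℚ_[p] K Ω r
  rw [← isIntegral_iff_spectralValuation_le_one]
  exact ⟨isIntegral_trans (R := PadicInt.subring p) x, fun h => h.tower_top⟩

variable {F : Type*} [Field F] [Algebra K F] [Algebra F Ω] [IsScalarTower K F Ω]

lemma mem_extIntegers_iff (x : F) :
    x ∈ extIntegers p K F ↔ spectralValuation p Ω (algebraMap F Ω x) ≤ 1 := by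
  rw [← isIntegral_padicIntegers_iff p (K := K), mem_integralClosure_iff]
  have : IsScalarTower (padicIntegers p K) F Ω :=
    IsScalarTower.of_algebraMap_eq fun r => IsScalarTower.algebraMap_apply K F Ω r
  exact (isIntegral_algebraMap_iff (algebraMap F Ω).injective).symm

lemma spectralValuation_padicIntegers_le_one (x : padicIntegers p K) :
    spectralValuation p Ω (algebraMap K Ω x) ≤ 1 := by
  rw [← isIntegral_padicIntegers_iff p (K := K)]
  exact isIntegral_algebraMap (x := x)

lemma isUnit_extIntegers_iff (x : extIntegers p K F) :
    IsUnit x ↔ spectralValuation p Ω (algebraMap F Ω x) = 1 := by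
  have hle : ∀ y : extIntegers p K F, spectralValuation p Ω (algebraMap F Ω y) ≤ 1 :=
    fun y => (mem_extIntegers_iff p _).1 y.2
  constructor
  · intro h
    obtain ⟨y, hy⟩ := h.exists_right_inv
    have h1 : spectralValuation p Ω (algebraMap F Ω x) * spectralValuation p Ω (algebraMap F Ω y)
        = 1 := by
      rw [← map_mul, ← map_mul, ← MulMemClass.coe_mul, hy]
      simp
    refine le_antisymm (hle x) ?_
    rw [← h1]
    exact mul_le_of_le_one_right' (hle y)
  · intro h
    have hx : (x : F) ≠ 0 := by
      intro h0
      simp [h0] at h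
    refine IsUnit.of_mul_eq_one ⟨(x : F)⁻¹, (mem_extIntegers_iff (Ω := Ω) p _).2 ?_⟩ ?_
    · rw [map_inv₀, map_inv₀, h, inv_one]
    · ext
      simp [hx]

end Valuation

/-- Nonunits are the elements of value less than `1`, and these are closed under addition. -/
lemma isLocalRing_extIntegers_of_algebra (p : ℕ) [Fact p.Prime] (K F Ω : Type*) [Field K]
    [Field F] [Field Ω] [Algebra ℚ_[p] K] [Algebra ℚ_[p] Ω] [Algebra.IsAlgebraic ℚ_[p] Ω]
    [Algebra K F] [Algebra K Ω] [Algebra F Ω] [IsScalarTower ℚ_[p] K Ω] [IsScalarTower K F Ω] : IsLocalRing (extIntegers p K F) := by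
  refine IsLocalRing.of_nonunits_add fun x y hx hy => ?_
  simp only [mem_nonunits_iff, isUnit_extIntegers_iff p (Ω := Ω)] at *
  have hle : ∀ y : extIntegers p K F, spectralValuation p Ω (algebraMap F Ω y) ≤ 1 :=
    fun y => (mem_extIntegers_iff p _).1 y.2
  refine ne_of_lt ?_
  rw [Subalgebra.coe_add, map_add]
  exact (spectralValuation p Ω).map_add_lt (lt_of_le_of_ne (hle _) hx) (lt_of_le_of_ne (hle _) hy)

lemma charZero_of_padic (p : ℕ) [Fact p.Prime] (K : Type*) [Field K] [Algebra ℚ_[p] K] :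
    CharZero K :=
  charZero_of_injective_algebraMap (algebraMap ℚ_[p] K).injective

/-! ### Dedekind property and finite residue fields -/

section Dedekind

variable (p : ℕ) [Fact p.Prime] (K : Type*) [Field K] [Algebra ℚ_[p] K] [FiniteDimensional ℚ_[p] K]

lemma isDedekindDomain_padicIntegers : IsDedekindDomain (padicIntegers p K) := by
  have : IsDedekindDomain (PadicInt.subring p) := inferInstanceAs (IsDedekindDomain ℤ_[p])
  have : IsFractionRing (PadicInt.subring p) ℚ_[p] := inferInstanceAs (IsFractionRing ℤ_[p] ℚ_[p])
  exact integralClosure.isDedekindDomain (PadicInt.subring p) ℚ_[p] K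

lemma isFractionRing_padicIntegers : IsFractionRing (padicIntegers p K) K := by
  have : IsFractionRing (PadicInt.subring p) ℚ_[p] := inferInstanceAs (IsFractionRing ℤ_[p] ℚ_[p])
  exact integralClosure.isFractionRing_of_finite_extension (A := PadicInt.subring p) ℚ_[p] K

/-- Residue fields of the valuation ring of a `p`-adic field are finite. -/
lemma finite_quotient_padicIntegers (P : Ideal (padicIntegers p K)) [P.IsMaximal] :
    Finite (padicIntegers p K ⧸ P) := by
  have : IsDedekindDomain (PadicInt.subring p) := inferInstanceAs (IsDedekindDomain ℤ_[p])
  have : IsFractionRing (PadicInt.subring p) ℚ_[p] := inferInstanceAs (IsFractionRing ℤ_[p] ℚ_[p])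
  have : IsLocalRing (PadicInt.subring p) := inferInstanceAs (IsLocalRing ℤ_[p])
  let : Algebra (PadicInt.subring p) (padicIntegers p K) :=
    inferInstanceAs (Algebra (PadicInt.subring p) (integralClosure (PadicInt.subring p) K))
  have hfin : Module.Finite (PadicInt.subring p) (padicIntegers p K) :=
    IsIntegralClosure.finite (PadicInt.subring p) ℚ_[p] K
      (integralClosure (PadicInt.subring p) K)
  have hP : P.under (PadicInt.subring p) = IsLocalRing.maximalIdeal (PadicInt.subring p) :=
    IsLocalRing.eq_maximalIdeal (Ideal.isMaximal_comap_of_isIntegral_of_isMaximal P)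
  have h1 : Finite (PadicInt.subring p ⧸ P.under (PadicInt.subring p)) := by
    rw [hP]
    exact Finite.of_equiv (ZMod p) (PadicInt.residueField (p := p)).symm.toEquiv
  have h2 : Module.Finite (PadicInt.subring p ⧸ P.under (PadicInt.subring p))
      (padicIntegers p K ⧸ P) := Module.Finite.of_restrictScalars_finite (PadicInt.subring p) _ _
  exact Module.finite_of_finite (PadicInt.subring p ⧸ P.under (PadicInt.subring p))

variable (F : Type*) [Field F] [Algebra K F] [FiniteDimensional K F]

lemma isDedekindDomain_extIntegers : IsDedekindDomain (extIntegers p K F) := by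
  have := isDedekindDomain_padicIntegers p K
  have := isFractionRing_padicIntegers p K
  have := charZero_of_padic p K
  exact integralClosure.isDedekindDomain (padicIntegers p K) K F

lemma finite_extIntegers : Module.Finite (padicIntegers p K) (extIntegers p K F) := by
  have := isDedekindDomain_padicIntegers p K
  have := isFractionRing_padicIntegers p K
  have := charZero_of_padic p K
  exact IsIntegralClosure.finite (padicIntegers p K) K F _

lemma isFractionRing_extIntegers : IsFractionRing (extIntegers p K F) F := by
  have := isFractionRing_padicIntegers p K
  exact integralClosure.isFractionRing_of_finite_extension (A := padicIntegers p K) K F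

end Dedekind

end

/-! ### Tameness forces `p`-power subextensions to be unramified -/

section

/-- A finite extension of local Dedekind domains of `p`-power degree which is contained in a
finite extension of ramification index prime to `p` is unramified. -/
lemma formallyUnramified_of_not_dvd_ramificationIdx {p s : ℕ} (hp : p.Prime) {A S T : Type*}
    [CommRing A] [CommRing S] [CommRing T] [Algebra A S] [Algebra A T] [Algebra S T]
    [IsScalarTower A S T] [IsDedekindDomain A] [IsDedekindDomain S] [IsDomain T]
    [IsLocalRing S] [IsLocalRing T] [Module.Finite A S] [Module.Finite A T]
    (hAS : Function.Injective (algebraMap A S)) (hST : Function.Injective (algebraMap S T))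
    (hs : Module.finrank A S = p ^ s)
    (hram : ¬ p ∣ (IsLocalRing.maximalIdeal T).ramificationIdx A)
    (hres : ∀ P : Ideal A, P.IsMaximal → Finite (A ⧸ P)) :
    Algebra.FormallyUnramified A S := by
  have : Module.Finite S T := Module.Finite.of_restrictScalars_finite A S T
  have : FaithfulSMul S T := (faithfulSMul_iff_algebraMap_injective S T).2 hST
  have : FaithfulSMul A S := (faithfulSMul_iff_algebraMap_injective A S).2 hAS
  let q := IsLocalRing.maximalIdeal S
  let r := IsLocalRing.maximalIdeal T
  have hr : r.LiesOver q :=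
    ⟨(IsLocalRing.eq_maximalIdeal (Ideal.isMaximal_comap_of_isIntegral_of_isMaximal r)).symm⟩
  have hdvd : q.ramificationIdx A ∣ r.ramificationIdx A := Ideal.ramificationIdx_below_dvd q r
  have hpq : ¬ p ∣ q.ramificationIdx A := fun h => hram (h.trans hdvd)
  have hAmax : (q.under A).IsMaximal := Ideal.isMaximal_comap_of_isIntegral_of_isMaximal q
  have hprimes : ∀ q' : Ideal S, q' ∈ (q.under A).primesOver S ↔ q' = q := by
    intro q'
    constructor
    · rintro ⟨h1, h2⟩
      have := Ideal.IsMaximal.of_liesOver_isMaximal q' (q.under A)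
      exact IsLocalRing.eq_maximalIdeal this
    · rintro rfl
      exact ⟨inferInstance, ⟨rfl⟩⟩
  let u : Unique ((q.under A).primesOver S) :=
    { default := ⟨q, (hprimes q).2 rfl⟩
      uniq := fun x => Subtype.ext ((hprimes x.1).1 x.2) }
  -- There is one prime above, so `e * f = p ^ s`: the index `e` is a power of `p`, yet it is prime
  -- to `p`.
  have hef := Ideal.sum_ramification_inertia_eq_finrank (q.under A) S
  rw [Fintype.sum_unique, hs] at hef
  have h1 : q.ramificationIdx A = 1 := by
    obtain ⟨j, -, hj⟩ := (Nat.dvd_prime_pow hp).1 (Dvd.intro _ hef)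
    change q.ramificationIdx A = p ^ j at hj
    rcases j with _ | j
    · simpa using hj
    · exact absurd (hj ▸ dvd_pow_self p (by simp)) hpq
  have := hres (q.under A) hAmax
  have : Finite (q.under A).ResidueField :=
    Finite.of_surjective _ (q.under A).bijective_algebraMap_quotient_residueField.2
  have hunr : Algebra.IsUnramifiedAt A q := Ideal.ramificationIdx_eq_one_iff.1 h1
  -- `S` is local, so localizing at its maximal ideal changes nothing.
  have e : S ≃ₐ[S] Localization.AtPrime q := IsLocalization.atUnits S q.primeCompl (by
    intro x hx
    by_contra hnon
    exact hx ((IsLocalRing.mem_maximalIdeal x).2 hnon))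
  have : Algebra.FormallyUnramified A (Localization.AtPrime q) := hunr
  exact Algebra.FormallyUnramified.of_equiv (e.restrictScalars A).symm

section Tame

variable (p : ℕ) [Fact p.Prime] (K : Type*) [Field K] [Algebra ℚ_[p] K] [FiniteDimensional ℚ_[p] K]

lemma isLocalRing_extIntegers (F : Type*) [Field F] [Algebra K F] [FiniteDimensional K F] :
    IsLocalRing (extIntegers p K F) := by
  let : Algebra ℚ_[p] F := ((algebraMap K F).comp (algebraMap ℚ_[p] K)).toAlgebra
  have : IsScalarTower ℚ_[p] K F := IsScalarTower.of_algebraMap_eq fun _ => rfl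
  have : FiniteDimensional ℚ_[p] F := FiniteDimensional.trans ℚ_[p] K F
  exact isLocalRing_extIntegers_of_algebra p K F F

lemma finrank_extIntegers (F : Type*) [Field F] [Algebra K F] [FiniteDimensional K F] :
    Module.finrank (padicIntegers p K) (extIntegers p K F) = Module.finrank K F := by
  have := isDedekindDomain_padicIntegers p K
  have := isFractionRing_padicIntegers p K
  have := isFractionRing_extIntegers p K F
  exact (IsFractionRing.finrank_eq (padicIntegers p K) K (extIntegers p K F) F).symm

/-- A subextension of `p`-power degree of a tame extension is unramified. -/
lemma formallyUnramified_of_isTame {F F' : Type*} [Field F] [Algebra K F] [FiniteDimensional K F]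
    [Field F'] [Algebra K F'] [FiniteDimensional K F'] (i : F →ₐ[K] F') (htame : IsTame p K F')
    {s : ℕ} (hs : Module.finrank K F = p ^ s) :
    Algebra.FormallyUnramified (padicIntegers p K) (extIntegers p K F) := by
  set A := padicIntegers p K
  set S := extIntegers p K F
  set T := extIntegers p K F'
  have := isDedekindDomain_padicIntegers p K
  have := isDedekindDomain_extIntegers p K F
  have := isDedekindDomain_extIntegers p K F'
  have := isLocalRing_extIntegers p K F
  have := isLocalRing_extIntegers p K F'
  have := finite_extIntegers p K F
  have := finite_extIntegers p K F'
  let f : S →ₐ[A] T := (i.restrictScalars A).mapIntegralClosure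
  have hf : Function.Injective f := fun x y h =>
    Subtype.ext (i.injective (congrArg Subtype.val h))
  let : Algebra S T := f.toRingHom.toAlgebra
  have : IsScalarTower A S T := IsScalarTower.of_algebraMap_eq fun a => (f.commutes a).symm
  exact formallyUnramified_of_not_dvd_ramificationIdx (T := T) Fact.out
    (fun x y h => Subtype.ext ((algebraMap K F).injective (congrArg Subtype.val h))) hf ((finrank_extIntegers p K F).trans hs)
    (htame _ inferInstance) fun P _ => finite_quotient_padicIntegers p K P

/-- Embeddings of a `p`-power degree subextension of a tame extension are distinct modulo the
maximal ideal. -/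
lemma algHom_eq_of_isTame {F F' E Ω : Type*} [Field F] [Algebra K F] [FiniteDimensional K F]
    [Field F'] [Algebra K F'] [FiniteDimensional K F'] (i : F →ₐ[K] F') (htame : IsTame p K F')
    {s : ℕ} (hs : Module.finrank K F = p ^ s)
    [Field E] [Algebra K E] [FiniteDimensional K E] [Field Ω] [Algebra ℚ_[p] Ω]
    [Algebra.IsAlgebraic ℚ_[p] Ω] [Algebra K Ω] [IsScalarTower ℚ_[p] K Ω] [Algebra E Ω]
    [IsScalarTower K E Ω] {g h : F →ₐ[K] E}
    (hgh : ∀ x ∈ extIntegers p K F, spectralValuation p Ω (algebraMap E Ω (g x - h x)) < 1) :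
    g = h := by
  have := isDedekindDomain_extIntegers p K E
  have := isLocalRing_extIntegers p K E
  have := isFractionRing_extIntegers p K F
  have := formallyUnramified_of_isTame p K i htame hs
  set A := padicIntegers p K
  set S := extIntegers p K F
  set I := IsLocalRing.maximalIdeal (extIntegers p K E)
  have key : (g.restrictScalars A).mapIntegralClosure = (h.restrictScalars A).mapIntegralClosure := by
    -- Maps from an unramified algebra that agree modulo `I` agree modulo all powers of `I`, whose
    -- intersection is zero by Krull.
    refine Algebra.FormallyUnramified.ext_of_iInf (I := I)
      (Ideal.iInf_pow_eq_bot_of_isLocalRing I (Ideal.IsPrime.ne_top inferInstance)) fun x => ?_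
    rw [Ideal.Quotient.eq, IsLocalRing.mem_maximalIdeal, mem_nonunits_iff,
      isUnit_extIntegers_iff p (Ω := Ω)]
    exact (hgh x x.2).ne
  ext x
  obtain ⟨a, b, hb, rfl⟩ := IsFractionRing.div_surjective (A := S) x
  have hk : ∀ y : S, g y = h y := fun y =>
    congrArg Subtype.val (DFunLike.congr_fun key y)
  rw [map_div₀, map_div₀]
  exact congrArg₂ (· / ·) (hk a) (hk b)

end Tame

end

/-! ### The generator criterion in terms of functions on `N` -/

section

/-- The image of `η ↦ η ^ m` is a `p`-group, and by Cauchy its kernel has order prime to `p`;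
compare the two coprime factorizations of `|N|`. -/
lemma card_torsionPart {N : Type*} [CommGroup N] [Finite N] {p a m : ℕ} (hp : p.Prime)
    (hpm : p.Coprime m) (hN : Nat.card N = p ^ a * m) : Nat.card (torsionPart N m) = m := by
  have : Fact p.Prime := ⟨hp⟩
  have hpow : ∀ η : N, η ^ (p ^ a * m) = 1 := fun η => by rw [← hN, pow_card_eq_one']
  have hm : m ≠ 0 := by
    rintro rfl
    exact Nat.card_pos.ne' (hN.trans (mul_zero _))
  set f := (powMonoidHom m : N →* N)
  have hcard : Nat.card f.range * Nat.card f.ker = p ^ a * m := by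
    rw [← hN, ← Subgroup.index_ker, mul_comm, Subgroup.card_mul_index]
  have hker : p.Coprime (Nat.card f.ker) := by
    rw [hp.coprime_iff_not_dvd]
    intro h
    obtain ⟨x, hx⟩ := exists_prime_orderOf_dvd_card' p h
    have h1 : (x : N) ^ m = 1 := x.2
    have h2 : orderOf (x : N) = p := by rw [Subgroup.orderOf_coe, hx]
    have h3 : p ∣ m := h2 ▸ orderOf_dvd_of_pow_eq_one h1
    exact (hp.coprime_iff_not_dvd.1 hpm) h3
  have hrange : IsPGroup p f.range := by
    rintro ⟨_, η, rfl⟩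
    refine ⟨a, Subtype.ext ?_⟩
    change (η ^ m) ^ p ^ a = 1
    rw [← pow_mul, mul_comm, hpow]
  obtain ⟨b, hb⟩ := IsPGroup.iff_card.1 hrange
  rw [hb] at hcard
  have h1 : Nat.card f.ker ∣ m :=
    (hker.symm.pow_right a).dvd_of_dvd_mul_left (Dvd.intro_left _ hcard)
  have h2 : m ∣ Nat.card f.ker :=
    (hpm.symm.pow_right b).dvd_of_dvd_mul_left (Dvd.intro_left _ hcard.symm)
  exact Nat.dvd_antisymm h1 h2

/-- A criterion for a lattice in a `Γ`-stable space of functions on a finite abelian group to have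
a generator over the invariant elements of the integral group ring. -/
theorem exists_convolution_generator {N Ω Γ V S O : Type*} [CommGroup N] [Fintype N] [Field Ω]
    [CharZero Ω] [IsAlgClosed Ω] [Group Γ] [CommRing S] [AddCommGroup V] [Module S V] [Monoid O]
    {p a m : ℕ} {v : Valuation Ω NNReal} {gal : Γ →* RingAut Ω} {cj : Γ →* MulAut N}
    (hp : p.Prime) (hvp : v p < 1) (hvm : v m = 1) (hpm : p.Coprime m)
    (hcard : Nat.card N = p ^ a * m) (hv : ∀ γ x, v (gal γ x) = v x)
    (φ : V →+ (N → Ω)) {B : Submodule S V} (hfg : B.FG)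
    (hS : ∀ (s : S) (x : V), ∃ r : Ω, v r ≤ 1 ∧ ∀ η, φ (s • x) η = r * φ x η)
    (hφ : ∀ γ, ∃ ρ : N, ∀ x ν, gal γ (φ x ν) = φ x (cj γ ν * ρ))
    (hB : ∀ z : N → Ω, (∀ η, v (z η) ≤ 1) → (∀ γ η, z (cj γ η) = gal γ (z η)) →
      ∀ x ∈ B, ∃ y ∈ B, ∀ ν, φ y ν = ∑ η, z η * φ x (η⁻¹ * ν))
    (hli : ∀ u : N → Ω, u 1 ≠ 0 → ∃ x ∈ B, ∑ η, u η * φ x η ≠ 0)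
    (c : N → O →* Ω) (hcv : ∀ η a, v (c η a) ≤ 1)
    (hc : ∀ η τ : N, τ ^ m = 1 → c (τ * η) = c η)
    (hc' : ∀ η ν : N, (∀ a, v (c η a - c ν a) < 1) → (ν / η) ^ m = 1)
    (hBO : ∀ (r : O), ∀ x ∈ B, ∃ y ∈ B, ∀ η, φ y η = c η r * φ x η) :
    ∃ t ∈ B, (∀ z : N → Ω, (∀ ν, ∑ η, z η * φ t (η⁻¹ * ν) = 0) → z = 0) ∧
      ∀ x ∈ B, ∃ w : N → Ω, (∀ η, v (w η) ≤ 1) ∧ (∀ γ η, w (cj γ η) = gal γ (w η)) ∧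
        ∀ ν, ∑ η, w η * φ t (η⁻¹ * ν) = φ x ν := by
  have hN : ∀ η : N, η ^ (p ^ a * m) = 1 := fun η => by rw [← hcard, pow_card_eq_one']
  have hQ := card_torsionPart hp hpm hcard
  have hpm' : Nat.Coprime (p ^ a) m := hpm.pow_left a
  let Φ : V →+ MonoidAlgebra Ω N :=
    { toFun := fun x => ofFun Ω (φ x)
      map_zero' := ext_coeff fun η => by simp
      map_add' := fun x y => ext_coeff fun η => by simp }
  have hΦ : ∀ x η, (Φ x).coeff η = φ x η := fun _ _ => rfl
  obtain ⟨t, ht, htu, htB⟩ := exists_generator (v := v) (gal := gal) (cj := cj) hp hvp hvm hpm' hN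
    hQ hv Φ B.toAddSubgroup hφ
    (by
      intro z hz hzi x hx
      obtain ⟨y, hy, hyx⟩ := hB z.coeff hz hzi x hx
      refine ⟨y, hy, ext_coeff fun ν => ?_⟩
      rw [coeff_mul_eq_sum]
      exact hyx ν)
    (by
      intro ψ
      let f : V →+ (N → Ω) :=
        { toFun := fun x => (charIdem ψ * Φ x).coeff
          map_zero' := by simp
          map_add' := fun x y => by
            rw [map_add, mul_add]
            rfl }
      obtain ⟨x₀, hx₀, η₀, hmax⟩ := exists_max_valuation_of_fg (v := v) f (fun s x η => by
        obtain ⟨r, hr, hrx⟩ := hS s x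
        have h1 : f (s • x) η = r * f x η := by
          have : Φ (s • x) = r • Φ x := ext_coeff fun η => by
            rw [MonoidAlgebra.coeff_smul_apply]
            exact hrx η
          change (charIdem ψ * Φ (s • x)).coeff η = r * (charIdem ψ * Φ x).coeff η
          rw [this, mul_smul_comm, MonoidAlgebra.coeff_smul_apply, smul_eq_mul]
        rw [h1, map_mul]
        exact mul_le_of_le_one_left' hr) hfg
      have hm : (m : Ω) ≠ 0 := by
        intro h
        simp [h] at hvm
      -- The functional is the coefficient at `1` of `e_ψ * Φ x`, so the `ψ`-component of `B` is
      -- nonzero.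
      obtain ⟨x₁, hx₁, hne⟩ := hli (fun η => (charIdem ψ).coeff η⁻¹) (by
        classical
        rw [coeff_charIdem, if_pos (by simp)]
        exact mul_ne_zero (inv_ne_zero hm) (Units.ne_zero _))
      have hne₁ : f x₁ 1 ≠ 0 := by
        change (charIdem ψ * Φ x₁).coeff 1 ≠ 0
        rw [coeff_mul_eq_sum]
        convert hne using 1
        refine Fintype.sum_equiv (Equiv.inv N) _ _ fun η => ?_
        simp [hΦ]
      refine exists_charEval_max hvm hpm' hN hQ c hcv hc hc' Φ B (fun r x hx => ?_) ψ hx₀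
        (η₀ := η₀) (fun h0 => ?_) hmax
      · exact hBO r x hx
      · have h1 := hmax x₁ hx₁ 1
        have h2 : f x₀ η₀ = 0 := h0
        rw [h2, map_zero, nonpos_iff_eq_zero, map_eq_zero] at h1
        exact hne₁ h1)
  refine ⟨t, ht, fun z hz => ?_, fun x hx => ?_⟩
  · have h0 : ofFun Ω z * Φ t = 0 := ext_coeff fun ν => by
      rw [coeff_mul_eq_sum]
      exact hz ν
    have h1 : ofFun Ω z = 0 := htu.mul_left_eq_zero.1 h0
    funext η
    rw [← coeff_ofFun z η, h1]
    rfl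
  · obtain ⟨w, hw, hwi, hwx⟩ := htB x hx
    refine ⟨w.coeff, hw, hwi, fun ν => ?_⟩
    rw [← hΦ x, ← hwx, coeff_mul_eq_sum]
    rfl

end

section

variable {K E : Type*} [Field K] [Field E] [Algebra K E] [FiniteDimensional K E]
  {L : IntermediateField K E} {N : Subgroup (Equiv.Perm (Cosets L))}

/-! ## Galois descent for the group algebra -/

omit [FiniteDimensional K E] in
lemma galAct_smul (hN : IsNormalizedByTranslations N) (g : Gal(E/K)) (c : E)
    (z : MonoidAlgebra E N) : galAct hN g (c • z) = g c • galAct hN g z := by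
  induction z using MonoidAlgebra.induction_linear with
  | zero => simp
  | add a b ha hb => rw [smul_add, map_add, ha, hb, map_add, smul_add]
  | single η d =>
    rw [MonoidAlgebra.smul_single, galAct_single, galAct_single, MonoidAlgebra.smul_single,
      smul_eq_mul, smul_eq_mul, map_mul]

omit [FiniteDimensional K E] in
lemma coe_conjHom (hN : IsNormalizedByTranslations N) (g : Gal(E/K)) (η : N) :
    ((conjHom hN g η : N) : Equiv.Perm (Cosets L)) =
      leftTranslation L g * η * (leftTranslation L g)⁻¹ := rfl

omit [FiniteDimensional K E] in
lemma conjHom_mul (hN : IsNormalizedByTranslations N) (g h : Gal(E/K)) (η : N) :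
    conjHom hN (g * h) η = conjHom hN g (conjHom hN h η) := by
  refine Subtype.ext ?_
  simp only [coe_conjHom, map_mul, mul_inv_rev, mul_assoc]

omit [FiniteDimensional K E] in
lemma conjHom_one (hN : IsNormalizedByTranslations N) (η : N) : conjHom hN 1 η = η := by
  refine Subtype.ext ?_
  simp only [coe_conjHom, map_one, inv_one, mul_one, one_mul]

omit [FiniteDimensional K E] in
lemma galAct_mul_apply (hN : IsNormalizedByTranslations N) (g h : Gal(E/K))
    (z : MonoidAlgebra E N) : galAct hN (g * h) z = galAct hN g (galAct hN h z) := by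
  induction z using MonoidAlgebra.induction_linear with
  | zero => simp
  | add a b ha hb => simp only [map_add, ha, hb]
  | single η d => rw [galAct_single, galAct_single, galAct_single, conjHom_mul]; rfl

omit [FiniteDimensional K E] in
lemma galAct_one_apply (hN : IsNormalizedByTranslations N)
    (z : MonoidAlgebra E N) : galAct hN 1 z = z := by
  induction z using MonoidAlgebra.induction_linear with
  | zero => simp
  | add a b ha hb => simp only [map_add, ha, hb]
  | single η d => rw [galAct_single, conjHom_one]; rfl

lemma sum_galAct_mem_fixedAlgebra (hN : IsNormalizedByTranslations N) (z : MonoidAlgebra E N) :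
    ∑ g : Gal(E/K), galAct hN g z ∈ fixedAlgebra hN := by
  rw [mem_fixedAlgebra]
  intro h
  rw [map_sum]
  refine Fintype.sum_equiv (Equiv.mulLeft h) _ _ fun g => ?_
  rw [Equiv.coe_mulLeft, galAct_mul_apply]

/-- The fixed algebra spans the group algebra. -/
lemma span_fixedAlgebra (hN : IsNormalizedByTranslations N) :
    Submodule.span E (fixedAlgebra hN : Set (MonoidAlgebra E N)) = ⊤ := by
  by_contra hne
  obtain ⟨f, hf, hle⟩ := Submodule.exists_le_ker_of_lt_top _ (lt_top_iff_ne_top.2 hne)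
  refine hf (LinearMap.ext fun z => ?_)
  -- A functional killing `H` kills the trace of every `c • z`. As a function of `c` this is a
  -- relation among automorphisms, which are linearly independent.
  have h1 : ∀ c : E, ∑ g : Gal(E/K), f (galAct hN g z) * g c = 0 := by
    intro c
    have : f (∑ g : Gal(E/K), galAct hN g (c • z)) = 0 :=
      hle (Submodule.subset_span (sum_galAct_mem_fixedAlgebra hN (c • z)))
    rw [map_sum] at this
    rw [← this]
    refine Finset.sum_congr rfl fun g _ => ?_
    rw [galAct_smul, map_smul, smul_eq_mul, mul_comm]
  have hli := (linearIndependent_toLinearMap K E E).comp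
    (fun g : Gal(E/K) => (g : E →ₐ[K] E)) (fun a b h => AlgEquiv.ext fun x =>
      DFunLike.congr_fun h x)
  have h2 := Fintype.linearIndependent_iff.1 hli (fun g => f (galAct hN g z)) (by
    ext c
    simpa using h1 c) 1
  simpa [galAct_one_apply] using h2

lemma mul_comm_of_fixedAlgebra (hN : IsNormalizedByTranslations N)
    (hcomm : ∀ z w : fixedAlgebra hN, z * w = w * z) (a b : N) : a * b = b * a := by
  have hcomm' : ∀ z w : MonoidAlgebra E N, z ∈ fixedAlgebra hN → w ∈ fixedAlgebra hN →
      z * w = w * z := fun z w hz hw => congrArg Subtype.val (hcomm ⟨z, hz⟩ ⟨w, hw⟩)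
  have h1 : ∀ z w : MonoidAlgebra E N, z * w = w * z := by
    intro z w
    have hz : z ∈ Submodule.span E (fixedAlgebra hN : Set (MonoidAlgebra E N)) := by
      rw [span_fixedAlgebra]; trivial
    have hw : w ∈ Submodule.span E (fixedAlgebra hN : Set (MonoidAlgebra E N)) := by
      rw [span_fixedAlgebra]; trivial
    induction hz, hw using Submodule.span_induction₂ with
    | mem_mem x y hx hy => exact hcomm' x y hx hy
    | zero_left y hy => simp
    | zero_right x hx => simp
    | add_left x y z _ _ _ h1 h2 => rw [add_mul, mul_add, h1, h2]
    | add_right x y z _ _ _ h1 h2 => rw [add_mul, mul_add, h1, h2]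
    | smul_left r x y _ _ h => rw [smul_mul_assoc, mul_smul_comm, h]
    | smul_right r x y _ _ h => rw [smul_mul_assoc, mul_smul_comm, h]
  have h2 := h1 (MonoidAlgebra.single a 1) (MonoidAlgebra.single b 1)
  rw [MonoidAlgebra.single_mul_single, MonoidAlgebra.single_mul_single] at h2
  exact (MonoidAlgebra.single_left_inj (by simp)).1 h2

/-! ## Regularity -/

omit [FiniteDimensional K E] in
lemma cosetEmb_injective :
    Function.Injective (cosetEmb : Cosets L → (L →ₐ[K] E)) := by
  intro y y' h
  induction y using QuotientGroup.induction_on with | H g => ?_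
  induction y' using QuotientGroup.induction_on with | H g' => ?_
  rw [QuotientGroup.eq, IntermediateField.mem_fixingSubgroup_iff]
  intro x hx
  have := DFunLike.congr_fun h ⟨x, hx⟩
  rw [cosetEmb_mk, cosetEmb_mk] at this
  change g⁻¹ (g' x) = x
  rw [← this]
  exact AlgEquiv.symm_apply_apply g x

omit [FiniteDimensional K E] in
lemma linearIndependent_cosetEmb : LinearIndependent E
    (fun y : Cosets L => (cosetEmb y).toLinearMap) :=
  (linearIndependent_toLinearMap K L E).comp _ cosetEmb_injective

variable [IsGalois K E]

/-- If `H` gives a Hopf–Galois structure, then `N` is transitive. -/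
lemma exists_apply_eq_of_jMap_surjective (hN : IsNormalizedByTranslations N)
    (hj : Function.Surjective (jMap hN)) (y : Cosets L) :
    ∃ η : N, (η : Equiv.Perm (Cosets L)) (QuotientGroup.mk 1) = y := by
  classical
  by_contra hcon
  let Y : Set (Cosets L) := {y | ∃ η : N, (η : Equiv.Perm (Cosets L)) (QuotientGroup.mk 1) = y}
  -- The map `j` only produces combinations of embeddings at points of the orbit `Y`. Together with
  -- `E`-linear combinations these exhaust `Hom_K(L, E)`, so no embedding can lie outside.
  let W := Submodule.span E ((fun y : Cosets L => (cosetEmb y).toLinearMap) '' Y)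
  have hW : ∀ u : Module.End K L, L.val.toLinearMap ∘ₗ u ∈ W := by
    intro u
    obtain ⟨s, rfl⟩ := hj u
    induction s using TensorProduct.induction_on with
    | zero => simp
    | add a b ha hb =>
      rw [map_add, LinearMap.comp_add]
      exact add_mem ha hb
    | tmul s h =>
      have : L.val.toLinearMap ∘ₗ jMap hN (s ⊗ₜ h) =
          ∑ η ∈ (h : MonoidAlgebra E N).coeff.support, ((s : E) * (h : MonoidAlgebra E N).coeff η) •
            (cosetEmb ((η : Equiv.Perm (Cosets L))⁻¹ (QuotientGroup.mk 1))).toLinearMap := by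
        ext t
        rw [LinearMap.comp_apply, jMap_tmul, LinearMap.sum_apply]
        change ((s * (h • t) : L) : E) = _
        rw [MulMemClass.coe_mul, coe_smul, Finsupp.sum, Finset.mul_sum]
        refine Finset.sum_congr rfl fun η _ => ?_
        simp [mul_assoc]
      rw [this]
      refine sum_mem fun η _ => Submodule.smul_mem _ _ (Submodule.subset_span ⟨_, ⟨η⁻¹, rfl⟩, rfl⟩)
  have hall : ∀ u : L →ₗ[K] E, u ∈ W := by
    intro u
    let b := Module.finBasis K L
    have : u = ∑ i, u (b i) • (L.val.toLinearMap ∘ₗ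
        ((LinearMap.toSpanSingleton K L 1) ∘ₗ (b.coord i))) := by
      refine b.ext fun j => ?_
      rw [LinearMap.sum_apply, Finset.sum_eq_single j]
      · simp
      · intro i _ hij
        simp [hij.symm]
      · simp
    rw [this]
    exact sum_mem fun i _ => Submodule.smul_mem _ _ (hW _)
  exact linearIndependent_cosetEmb.notMem_span_image (s := Y) (x := y) hcon (hall _)

omit [FiniteDimensional K E] [IsGalois K E] in
/-- A commutative transitive permutation group is regular. -/
lemma apply_injective_of_transitive (hc : ∀ a b : N, a * b = b * a)
    (ht : ∀ y : Cosets L, ∃ η : N, (η : Equiv.Perm (Cosets L)) (QuotientGroup.mk 1) = y) :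
    Function.Injective (fun η : N => (η : Equiv.Perm (Cosets L)) (QuotientGroup.mk 1)) := by
  intro a b hab
  refine Subtype.ext (Equiv.ext fun y => ?_)
  obtain ⟨η, rfl⟩ := ht y
  have h1 : ∀ c : N, (c : Equiv.Perm (Cosets L)) ((η : Equiv.Perm (Cosets L)) (QuotientGroup.mk 1))
      = (η : Equiv.Perm (Cosets L)) ((c : Equiv.Perm (Cosets L)) (QuotientGroup.mk 1)) := by
    intro c
    rw [← Equiv.Perm.mul_apply, ← Equiv.Perm.mul_apply, ← Subgroup.coe_mul, hc, Subgroup.coe_mul]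
  rw [h1, h1]
  exact congrArg _ hab

omit [FiniteDimensional K E] [IsGalois K E] in
lemma smul_apply_eq (hN : IsNormalizedByTranslations N) (g : Gal(E/K)) (η : N) (y : Cosets L) :
    g • ((η : Equiv.Perm (Cosets L)) y) = (conjHom hN g η : Equiv.Perm (Cosets L)) (g • y) := by
  simp [coe_conjHom]

/-! ## The block of the torsion part -/

/-- The stabilizer in `Gal(E/K)` of the orbit of the trivial coset under the `m`-torsion of `N`. -/
def blockStabilizer (hN : IsNormalizedByTranslations N) (hc : ∀ a b : N, a * b = b * a) (m : ℕ) :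
    Subgroup Gal(E/K) where
  carrier := {g | ∃ τ : N, τ ^ m = 1 ∧
    g • (QuotientGroup.mk 1 : Cosets L) = (τ : Equiv.Perm (Cosets L)) (QuotientGroup.mk 1)}
  one_mem' := ⟨1, one_pow _, by simp⟩
  mul_mem' := by
    rintro g h ⟨τ, hτ, hg⟩ ⟨σ, hσ, hh⟩
    refine ⟨conjHom hN g σ * τ, ?_, ?_⟩
    · rw [(show Commute _ _ from hc _ _).mul_pow, ← map_pow, hσ, hτ, map_one, one_mul]
    · rw [mul_smul, hh, smul_apply_eq hN, hg]
      rfl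
  inv_mem' := by
    rintro g ⟨τ, hτ, hg⟩
    refine ⟨(conjHom hN g⁻¹ τ)⁻¹, ?_, ?_⟩
    · rw [inv_pow, ← map_pow, hτ, map_one, inv_one]
    · have := smul_apply_eq hN g⁻¹ τ (QuotientGroup.mk 1)
      rw [← hg, inv_smul_smul] at this
      rw [InvMemClass.coe_inv, Equiv.Perm.eq_inv_iff_eq]
      exact this.symm

omit [FiniteDimensional K E] [IsGalois K E] in
lemma fixingSubgroup_le_blockStabilizer (hN : IsNormalizedByTranslations N)
    (hc : ∀ a b : N, a * b = b * a) (m : ℕ) :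
    L.fixingSubgroup ≤ blockStabilizer hN hc m := by
  intro g hg
  refine ⟨1, one_pow _, ?_⟩
  change (QuotientGroup.mk (g * 1) : Cosets L) = QuotientGroup.mk 1
  rw [QuotientGroup.eq]
  simpa using hg

omit [FiniteDimensional K E] [IsGalois K E] in
/-- The block stabilizer has index `|N| / |N[m]|`. -/
lemma card_mul_index_blockStabilizer (hN : IsNormalizedByTranslations N)
    (hc : ∀ a b : N, a * b = b * a)
    (hreg : Function.Bijective
      (fun η : N => (η : Equiv.Perm (Cosets L)) (QuotientGroup.mk 1))) (m : ℕ) :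
    Nat.card {τ : N // τ ^ m = 1} * (blockStabilizer hN hc m).index = Nat.card N := by
  have h0 : L.fixingSubgroup.index = Nat.card N := by
    rw [Subgroup.index_eq_card, Nat.card_eq_of_bijective _ hreg]
  rw [← h0, ← Subgroup.relIndex_mul_index (fixingSubgroup_le_blockStabilizer hN hc m)]
  congr 1
  let G' := blockStabilizer hN hc m
  -- The second factor is an orbit size: `Gal(E/L)` is the stabilizer of `1̄`, and by regularity its
  -- orbit under the block stabilizer is a copy of `N[m]`.
  have hstab : L.fixingSubgroup.subgroupOf G' =
      MulAction.stabilizer G' (QuotientGroup.mk 1 : Cosets L) := by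
    ext g
    rw [Subgroup.mem_subgroupOf, MulAction.mem_stabilizer_iff]
    change _ ↔ (QuotientGroup.mk ((g : Gal(E/K)) * 1) : Cosets L) = QuotientGroup.mk 1
    rw [QuotientGroup.eq]
    simp
  rw [Subgroup.relIndex, hstab, MulAction.index_stabilizer, ← Nat.card_coe_set_eq]
  refine Nat.card_congr (Equiv.ofBijective
    (fun τ => ⟨((τ : N) : Equiv.Perm (Cosets L)) (QuotientGroup.mk 1), ?_⟩) ⟨?_, ?_⟩)
  · obtain ⟨g, hg⟩ := QuotientGroup.mk_surjective
      (((τ : N) : Equiv.Perm (Cosets L)) (QuotientGroup.mk 1))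
    have hg' : g • (QuotientGroup.mk 1 : Cosets L) =
        ((τ : N) : Equiv.Perm (Cosets L)) (QuotientGroup.mk 1) := by
      rw [← hg]
      change (QuotientGroup.mk (g * 1) : Cosets L) = _
      rw [mul_one]
    exact ⟨⟨g, τ, τ.2, hg'⟩, hg'⟩
  · intro τ σ h
    exact Subtype.ext (hreg.1 (congrArg Subtype.val h))
  · rintro ⟨_, ⟨g, τ, hτ, hg⟩, rfl⟩
    exact ⟨⟨τ, hτ⟩, Subtype.ext hg.symm⟩

end

/-! ### Action of `H` through the embeddings of `L` -/

section

variable {K E : Type*} [Field K] [Field E] [Algebra K E]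
  {L : IntermediateField K E} {N : Subgroup (Equiv.Perm (Cosets L))}

/-- The action of `Gal(E/K)` on `N` by conjugation. -/
def conjAut (hN : IsNormalizedByTranslations N) : Gal(E/K) →* MulAut N where
  toFun g :=
    { conjHom hN g with
      invFun := conjHom hN g⁻¹
      left_inv := fun η => by
        change conjHom hN g⁻¹ (conjHom hN g η) = η
        rw [← conjHom_mul, inv_mul_cancel, conjHom_one]
      right_inv := fun η => by
        change conjHom hN g (conjHom hN g⁻¹ η) = η
        rw [← conjHom_mul, mul_inv_cancel, conjHom_one] }
  map_one' := MulEquiv.ext fun η => conjHom_one hN η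
  map_mul' g h := MulEquiv.ext fun η => conjHom_mul hN g h η

lemma conjAut_apply (hN : IsNormalizedByTranslations N) (g : Gal(E/K)) (η : N) :
    conjAut hN g η = conjHom hN g η := rfl

lemma conjHom_injective (hN : IsNormalizedByTranslations N) (g : Gal(E/K)) :
    Function.Injective (conjHom hN g) := (conjAut hN g).injective

lemma coeff_galAct (hN : IsNormalizedByTranslations N) (g : Gal(E/K)) (z : MonoidAlgebra E N)
    (η : N) : (galAct hN g z).coeff (conjHom hN g η) = g (z.coeff η) := by
  classical
  induction z using MonoidAlgebra.induction_linear with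
  | zero => simp
  | add a b ha hb =>
    rw [map_add, MonoidAlgebra.coeff_add, MonoidAlgebra.coeff_add, Finsupp.add_apply,
      Finsupp.add_apply, ha, hb, map_add]
  | single ν c =>
    rw [galAct_single, MonoidAlgebra.coeff_single, MonoidAlgebra.coeff_single,
      Finsupp.single_apply, Finsupp.single_apply]
    simp only [(conjHom_injective hN g).eq_iff]
    split_ifs <;> simp

lemma exists_smul_mk_one (y : Cosets L) :
    ∃ g : Gal(E/K), g • (QuotientGroup.mk 1 : Cosets L) = y := by
  obtain ⟨g, rfl⟩ := QuotientGroup.mk_surjective y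
  refine ⟨g, ?_⟩
  change (QuotientGroup.mk (g * 1) : Cosets L) = _
  rw [mul_one]

lemma cosetEmb_one (x : L) : cosetEmb (QuotientGroup.mk 1 : Cosets L) x = x := rfl

section

variable [FiniteDimensional K E] [IsGalois K E]

/-- The action is defined at `1̄`; Galois invariance of `z` carries the formula to every coset,
which makes the action a convolution on `N`. -/
lemma cosetEmb_fixedAlgebra_smul {hN : IsNormalizedByTranslations N} (z : fixedAlgebra hN) (x : L)
    (y : Cosets L) : cosetEmb y (z • x) = evalAt N y x z := by
  obtain ⟨g, rfl⟩ := exists_smul_mk_one y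
  rw [cosetEmb_smul, cosetEmb_one, ← galois_evalAt_of_mem]
  rfl

end

section AlgClosure

variable (Ω : Type*) [Field Ω] [Algebra K Ω] [Algebra E Ω] [IsScalarTower K E Ω]

/-- The embedding of `L` in an extension of `E` attached to a coset. -/
def cosetEmbExt (y : Cosets L) : L →ₐ[K] Ω := (IsScalarTower.toAlgHom K E Ω).comp (cosetEmb y)

variable {Ω}

lemma cosetEmbExt_apply (y : Cosets L) (x : L) :
    cosetEmbExt Ω y x = algebraMap E Ω (cosetEmb y x) := rfl

lemma linearIndependent_cosetEmbExt :
    LinearIndependent Ω (fun y : Cosets L => (cosetEmbExt Ω y).toLinearMap) := by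
  refine (linearIndependent_toLinearMap K L Ω).comp (fun y : Cosets L => cosetEmbExt Ω y) ?_
  intro y y' h
  refine cosetEmb_injective (AlgHom.ext fun x => (algebraMap E Ω).injective ?_)
  exact DFunLike.congr_fun h x

variable [IsGalois K E]

lemma galois_cosetEmbExt (γ : Gal(Ω/K)) (y : Cosets L) (x : L) :
    γ (cosetEmbExt Ω y x) = cosetEmbExt Ω (AlgEquiv.restrictNormalHom E γ • y) x := by
  rw [cosetEmbExt_apply, cosetEmbExt_apply, cosetEmb_smul]
  exact (AlgEquiv.restrictNormal_commutes γ E _).symm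

/-- Elements of `Ω[N]` invariant under `Gal(Ω/K)` come from the fixed algebra. -/
lemma exists_fixedAlgebra_of_invariant [Finite N] [Normal K Ω] [IsGalois E Ω]
    (hN : IsNormalizedByTranslations N) {z : N → Ω}
    (hz : ∀ (γ : Gal(Ω/K)) (η : N),
      z (conjHom hN (AlgEquiv.restrictNormalHom E γ) η) = γ (z η)) :
    ∃ h : fixedAlgebra hN, ∀ η, algebraMap E Ω ((h : MonoidAlgebra E N).coeff η) = z η := by
  have hrange : ∀ η, ∃ c : E, algebraMap E Ω c = z η := by
    intro η
    refine (InfiniteGalois.mem_range_algebraMap_iff_fixed (z η)).2 fun δ => ?_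
    -- Automorphisms over `E` act trivially on `N`, so invariance places each coefficient in `E`.
    have h1 : AlgEquiv.restrictNormalHom E (δ.restrictScalars K) = (1 : Gal(E/K)) := by
      ext x
      apply (algebraMap E Ω).injective
      refine (AlgEquiv.restrictNormal_commutes (δ.restrictScalars K) E x).trans ?_
      exact δ.commutes x
    have h2 := hz (δ.restrictScalars K) η
    rw [h1, conjHom_one] at h2
    exact h2.symm
  choose c hc using hrange
  refine ⟨⟨ofFun E c, ?_⟩, hc⟩
  rw [mem_fixedAlgebra]
  intro g
  obtain ⟨γ, rfl⟩ := AlgEquiv.restrictNormalHom_surjective (F := K) (K₁ := E) Ω g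
  refine ext_coeff fun ν => ?_
  obtain ⟨η, rfl⟩ := (conjAut hN (AlgEquiv.restrictNormalHom E γ)).surjective ν
  rw [conjAut_apply, coeff_galAct]
  apply (algebraMap E Ω).injective
  change algebraMap E Ω (γ.restrictNormal E (c η)) = algebraMap E Ω (c _)
  rw [AlgEquiv.restrictNormal_commutes, hc, hc, hz]

variable {p : ℕ} [Fact p.Prime] [Algebra ℚ_[p] K] [FiniteDimensional ℚ_[p] K] [Algebra ℚ_[p] Ω]
  [Algebra.IsAlgebraic ℚ_[p] Ω] [IsScalarTower ℚ_[p] K Ω]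

omit [FiniteDimensional ℚ_[p] K] in
-- The coset embeddings are conjugate over `K`, and the spectral norm is Galois invariant.
lemma spectralValuation_cosetEmbExt [Normal K Ω] (y : Cosets L) (x : L) :
    spectralValuation p Ω (cosetEmbExt Ω y x) = spectralValuation p Ω (algebraMap E Ω x) := by
  obtain ⟨g, rfl⟩ := exists_smul_mk_one y
  obtain ⟨γ, rfl⟩ := AlgEquiv.restrictNormalHom_surjective (F := K) (K₁ := E) Ω g
  rw [← galois_cosetEmbExt]
  exact spectralValuation_algEquiv p (γ.restrictScalars ℚ_[p]) _

omit [IsGalois K E] [FiniteDimensional ℚ_[p] K] in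
-- Membership is governed by valuation alone: `y / x` is integral when `x ≠ 0`.
lemma mem_fractionalIdeal_of_le {B : FractionalIdeal (nonZeroDivisors (extIntegers p K L)) L}
    {x y : L} (hx : x ∈ B)
    (hle : spectralValuation p Ω (algebraMap E Ω y) ≤ spectralValuation p Ω (algebraMap E Ω x)) :
    y ∈ B := by
  have : IsScalarTower K L Ω := IsScalarTower.of_algebraMap_eq fun r => by
    rw [IsScalarTower.algebraMap_apply K E Ω]
    rfl
  by_cases h0 : x = 0
  · subst h0
    have : y = 0 := by
      simpa using hle
    rw [this]
    exact B.zero_mem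
  have hmem : y / x ∈ extIntegers p K L := by
    rw [mem_extIntegers_iff p (Ω := Ω)]
    change spectralValuation p Ω (algebraMap E Ω ((y / x : L) : E)) ≤ 1
    have : ((y / x : L) : E) = y / x := rfl
    rw [this, map_div₀, map_div₀]
    exact div_le_one_of_le₀ hle zero_le
  have h1 := (B : Submodule (extIntegers p K L) L).smul_mem ⟨y / x, hmem⟩ hx
  have h2 : (⟨y / x, hmem⟩ : extIntegers p K L) • x = y := div_mul_cancel₀ y h0
  rw [h2] at h1
  exact h1

variable [FiniteDimensional K E]

omit [FiniteDimensional ℚ_[p] K] in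
/-- Fractional ideals are stable under the integral fixed ring. -/
lemma integralFixedRing_smul_mem [Normal K Ω] {hN : IsNormalizedByTranslations N}
    {B : FractionalIdeal (nonZeroDivisors (extIntegers p K L)) L} {x : L} (hx : x ∈ B)
    {z : fixedAlgebra hN} (hz : z ∈ integralFixedRing p hN) : z • x ∈ B := by
  refine mem_fractionalIdeal_of_le (Ω := Ω) hx ?_
  rw [coe_smul, Finsupp.sum, map_sum]
  refine Valuation.map_sum_le _ fun η _ => ?_
  rw [map_mul, map_mul]
  have h1 := (mem_extIntegers_iff (Ω := Ω) p ((z : MonoidAlgebra E N).coeff η)).1 (hz η)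
  refine (mul_le_of_le_one_left' h1).trans_eq ?_
  exact spectralValuation_cosetEmbExt _ x

end AlgClosure

end

/-! ### The field of the `N[m]`-block and generators of fractional ideals -/

section

variable {K E : Type*} [Field K] [Field E] [Algebra K E]
  {L : IntermediateField K E} {N : Subgroup (Equiv.Perm (Cosets L))}

/-- A commutative subgroup of a permutation group as a commutative group. -/
abbrev commGroupOfComm (hc : ∀ a b : N, a * b = b * a) : CommGroup N :=
  { (inferInstance : Group N) with mul_comm := hc }

lemma fg_restrictScalars_fractionalIdeal {A R F : Type*} [CommRing A] [CommRing R] [IsDomain R]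
    [IsNoetherianRing R] [Field F] [Algebra A R] [Algebra R F] [Algebra A F] [IsScalarTower A R F]
    [IsFractionRing R F] [Module.Finite A R] (B : FractionalIdeal (nonZeroDivisors R) F) :
    ((B : Submodule R F).restrictScalars A).FG := by
  have h : (B : Submodule R F).FG :=
    isNoetherian_submodule.1 (FractionalIdeal.isNoetherian B) _ le_rfl
  exact h.restrictScalars

lemma conjHom_pow_eq_one (hN : IsNormalizedByTranslations N) {m : ℕ} (g : Gal(E/K)) {τ : N} (hτ : τ ^ m = 1) :
    (conjHom hN g τ) ^ m = 1 := by
  rw [← map_pow, hτ, map_one]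

variable [FiniteDimensional K E] {p : ℕ} [Fact p.Prime] [Algebra ℚ_[p] K]
  [FiniteDimensional ℚ_[p] K]

lemma fg_fractionalIdeal (B : FractionalIdeal (nonZeroDivisors (extIntegers p K L)) L) :
    ((B : Submodule (extIntegers p K L) L).restrictScalars (padicIntegers p K)).FG := by
  have := isDedekindDomain_extIntegers p K L
  have := isFractionRing_extIntegers p K L
  have := finite_extIntegers p K L
  exact fg_restrictScalars_fractionalIdeal B

variable [IsGalois K E]

section Block

variable (hN : IsNormalizedByTranslations N) (hc : ∀ a b : N, a * b = b * a)

/-- The fixed field of the block stabilizer. -/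
abbrev blockField (m : ℕ) : IntermediateField K E :=
  IntermediateField.fixedField (blockStabilizer hN hc m)

lemma blockField_le (m : ℕ) : blockField hN hc m ≤ L := by
  have h := IsGalois.fixedField_fixingSubgroup L
  intro x hx
  rw [← h, IntermediateField.mem_fixedField_iff]
  intro g hg
  exact (IntermediateField.mem_fixedField_iff _ _).1 hx g
    (fixingSubgroup_le_blockStabilizer hN hc m hg)

/-- The embeddings of the fixed field of the block stabilizer. -/
def blockEmb (m : ℕ) (η : N) : blockField hN hc m →ₐ[K] E :=
  (cosetEmb ((η : Equiv.Perm (Cosets L)) (QuotientGroup.mk 1))).comp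
    (IntermediateField.inclusion (blockField_le hN hc m))

lemma blockEmb_apply {m : ℕ} {η : N} {g : Gal(E/K)}
    (hg : g • (QuotientGroup.mk 1 : Cosets L) =
      (η : Equiv.Perm (Cosets L)) (QuotientGroup.mk 1)) (x : blockField hN hc m) :
    blockEmb hN hc m η x = g x := by
  rw [blockEmb, ← hg]
  rfl

/-- If `g` carries `1̄` to `η(1̄)`, then `τη(1̄)` is reached by `g * k` with `k` carrying `1̄` to
its image under `g⁻¹τg`, again `m`-torsion. So `k` fixes the block field. -/
lemma blockEmb_mul {m : ℕ} (η : N) {τ : N} (hτ : τ ^ m = 1) :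
    blockEmb hN hc m (τ * η) = blockEmb hN hc m η := by
  obtain ⟨g, hg⟩ := exists_smul_mk_one ((η : Equiv.Perm (Cosets L)) (QuotientGroup.mk 1))
  obtain ⟨k, hk⟩ := exists_smul_mk_one
    ((conjHom hN g⁻¹ τ : Equiv.Perm (Cosets L)) (QuotientGroup.mk 1))
  have hgk : (g * k) • (QuotientGroup.mk 1 : Cosets L) =
      ((τ * η : N) : Equiv.Perm (Cosets L)) (QuotientGroup.mk 1) := by
    rw [mul_smul, hk, smul_apply_eq hN, ← conjHom_mul, mul_inv_cancel, conjHom_one, hg]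
    rfl
  ext x
  rw [blockEmb_apply hN hc hgk, blockEmb_apply hN hc hg, AlgEquiv.mul_apply]
  congr 1
  exact (IntermediateField.mem_fixedField_iff _ _).1 x.2 k
    ⟨_, conjHom_pow_eq_one hN g⁻¹ hτ, hk⟩

/-- By the Galois correspondence, group elements with equal restriction to the block field differ by
an element of the block stabilizer; regularity turns this into an `m`-torsion quotient in `N`. -/
lemma pow_div_eq_one_of_blockEmb_eq
    (hinj : Function.Injective
      (fun η : N => (η : Equiv.Perm (Cosets L)) (QuotientGroup.mk 1)))
    {m : ℕ} {η ν : N} (h : blockEmb hN hc m η = blockEmb hN hc m ν) : (ν / η) ^ m = 1 := by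
  obtain ⟨g, hg⟩ := exists_smul_mk_one ((η : Equiv.Perm (Cosets L)) (QuotientGroup.mk 1))
  obtain ⟨k, hk⟩ := exists_smul_mk_one ((ν : Equiv.Perm (Cosets L)) (QuotientGroup.mk 1))
  have h1 : g⁻¹ * k ∈ blockStabilizer hN hc m := by
    rw [← IntermediateField.fixingSubgroup_fixedField (blockStabilizer hN hc m),
      IntermediateField.mem_fixingSubgroup_iff]
    intro x hx
    have h2 := DFunLike.congr_fun h ⟨x, hx⟩
    rw [blockEmb_apply hN hc hg, blockEmb_apply hN hc hk] at h2
    change g⁻¹ (k x) = x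
    rw [← h2]
    exact AlgEquiv.symm_apply_apply g x
  obtain ⟨τ, hτ, hτ'⟩ := h1
  have h3 : ν = conjHom hN g τ * η := by
    apply hinj
    change (ν : Equiv.Perm (Cosets L)) (QuotientGroup.mk 1) =
      ((conjHom hN g τ * η : N) : Equiv.Perm (Cosets L)) (QuotientGroup.mk 1)
    rw [← hk, Subgroup.coe_mul, Equiv.Perm.mul_apply, ← hg, ← smul_apply_eq hN, ← hτ', mul_smul,
      smul_inv_smul]
  rw [h3, mul_div_cancel_right]
  exact conjHom_pow_eq_one hN g hτ

end Block

/-- A nonzero fractional ideal is free of rank one over the integral fixed ring. -/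
theorem exists_generator_fractionalIdeal
    {Ω : Type*} [Field Ω] [CharZero Ω] [IsAlgClosed Ω] [Algebra K Ω] [Algebra E Ω]
    [IsScalarTower K E Ω] [Algebra ℚ_[p] Ω] [Algebra.IsAlgebraic ℚ_[p] Ω]
    [IsScalarTower ℚ_[p] K Ω] [Normal K Ω] [IsGalois E Ω]
    (htame : IsTame p K L) (hN : IsNormalizedByTranslations N)
    (hj : Function.Surjective (jMap hN))
    (hcomm : ∀ z w : fixedAlgebra hN, z * w = w * z)
    {B : FractionalIdeal (nonZeroDivisors (extIntegers p K L)) L} (hB0 : B ≠ 0) :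
    ∃ t ∈ B, (∀ z : fixedAlgebra hN, z • t = 0 → z = 0) ∧
      ∀ x ∈ B, ∃ z ∈ integralFixedRing p hN, z • t = x := by
  have hc := mul_comm_of_fixedAlgebra hN hcomm
  have htrans := exists_apply_eq_of_jMap_surjective hN hj
  have hinj := apply_injective_of_transitive hc htrans
  let : CommGroup N := commGroupOfComm hc
  let : Fintype N := Fintype.ofFinite N
  set v := spectralValuation p Ω
  have hp : p.Prime := Fact.out
  obtain ⟨a, m, hm, hcard⟩ := Nat.exists_eq_pow_mul_and_not_dvd (n := Nat.card N)
    Nat.card_pos.ne' p hp.ne_one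
  have hpm : p.Coprime m := hp.coprime_iff_not_dvd.2 hm
  have htower : IsScalarTower K L Ω := IsScalarTower.of_algebraMap_eq fun r => by
    rw [IsScalarTower.algebraMap_apply K E Ω]
    rfl
  let gal : Gal(Ω/K) →* RingAut Ω := MulSemiringAction.toRingAut Gal(Ω/K) Ω
  let cj : Gal(Ω/K) →* MulAut N := (conjAut hN).comp (AlgEquiv.restrictNormalHom E)
  let φ : L →+ (N → Ω) :=
    { toFun := fun x η => cosetEmbExt Ω ((η : Equiv.Perm (Cosets L)) (QuotientGroup.mk 1)) x
      map_zero' := by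
        funext η
        exact map_zero _
      map_add' := fun x y => by
        funext η
        exact map_add _ _ _ }
  have hφ : ∀ (x : L) (η : N),
      φ x η = cosetEmbExt Ω ((η : Equiv.Perm (Cosets L)) (QuotientGroup.mk 1)) x := fun _ _ => rfl
  have hvφ : ∀ (x : L) (η : N), v (φ x η) = v (algebraMap E Ω x) := fun x η =>
    spectralValuation_cosetEmbExt _ x
  have hact : ∀ (z : fixedAlgebra hN) (x : L) (ν : N),
      φ (z • x) ν =
        ∑ η : N, algebraMap E Ω ((z : MonoidAlgebra E N).coeff η) * φ x (η⁻¹ * ν) := by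
    intro z x ν
    rw [hφ, cosetEmbExt_apply, cosetEmb_fixedAlgebra_smul, evalAt_apply,
      Finsupp.sum_fintype _ _ (by simp), map_sum]
    refine Finset.sum_congr rfl fun η _ => ?_
    rw [map_mul]
    rfl
  have hinv : ∀ z : N → Ω, (∀ γ η, z (cj γ η) = gal γ (z η)) →
      ∃ h : fixedAlgebra hN, ∀ η, algebraMap E Ω ((h : MonoidAlgebra E N).coeff η) = z η :=
    fun z hz => exists_fixedAlgebra_of_invariant hN hz
  have hint : ∀ h : fixedAlgebra hN,
      (∀ η, v (algebraMap E Ω ((h : MonoidAlgebra E N).coeff η)) ≤ 1) →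
      h ∈ integralFixedRing p hN := fun h hh η => (mem_extIntegers_iff p _).2 (hh η)
  have hindex : (blockStabilizer hN hc m).index = p ^ a := by
    have h1 := card_mul_index_blockStabilizer hN hc ⟨hinj, htrans⟩ m
    have h2 : Nat.card {τ : N // τ ^ m = 1} = m := card_torsionPart hp hpm hcard
    rw [h2, hcard, mul_comm] at h1
    refine Nat.eq_of_mul_eq_mul_right (Nat.pos_of_ne_zero ?_) h1
    rintro rfl
    exact hm (dvd_zero p)
  have hfinrank : Module.finrank K (blockField hN hc m) = p ^ a := by
    rw [IntermediateField.finrank_eq_fixingSubgroup_index,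
      IntermediateField.fixingSubgroup_fixedField, hindex]
  obtain ⟨t, htB, htinj, hts⟩ := exists_convolution_generator
    (O := extIntegers p K (blockField hN hc m))
    (v := v) (gal := gal) (cj := cj) hp (spectralValuation_p_lt_one p Ω)
    (spectralValuation_natCast_eq_one p Ω hpm) hpm hcard
    (fun γ x => spectralValuation_algEquiv p (γ.restrictScalars ℚ_[p]) x) φ (fg_fractionalIdeal B)
    (fun s x => ⟨algebraMap K Ω s, spectralValuation_padicIntegers_le_one p s, fun η => by
      rw [hφ, hφ, Subring.smul_def, map_smul, Algebra.smul_def]⟩)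
    (by
      intro γ
      -- `ρ` is the element of `N` that moves `1̄` where `γ` does.
      obtain ⟨ρ, hρ⟩ := htrans (AlgEquiv.restrictNormalHom E γ • QuotientGroup.mk 1)
      refine ⟨ρ, fun x ν => ?_⟩
      rw [hφ, hφ]
      refine (galois_cosetEmbExt γ _ x).trans ?_
      rw [smul_apply_eq hN, ← hρ]
      rfl)
    (by
      intro z hz hzi x hx
      obtain ⟨h, hh⟩ := hinv z hzi
      refine ⟨h • x, integralFixedRing_smul_mem (Ω := Ω) hx
        (hint h fun η => by rw [hh]; exact hz η), fun ν => ?_⟩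
      rw [hact]
      simp only [hh])
    (by
      intro u hu
      obtain ⟨b, hbB, hb⟩ : ∃ b ∈ B, b ≠ 0 := by
        by_contra hcon
        push Not at hcon
        exact hB0 (FractionalIdeal.eq_zero_iff.2 hcon)
      have hli := (linearIndependent_cosetEmbExt (L := L) (Ω := Ω)).comp _ hinj
      obtain ⟨x, hx⟩ : ∃ x : L, ∑ η, u η * φ x η ≠ 0 := by
        by_contra hcon
        push Not at hcon
        refine hu (Fintype.linearIndependent_iff.1 hli u ?_ 1)
        ext x
        rw [LinearMap.sum_apply]
        exact hcon x
      have hvb : 0 < v (algebraMap E Ω b) := by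
        rw [pos_iff_ne_zero, v.ne_zero_iff]
        simpa using hb
      -- A large power of `p` brings `x` into `B` and only scales the nonzero sum.
      obtain ⟨n, hn⟩ : ∃ n : ℕ, v p ^ n * v (algebraMap E Ω x) ≤ v (algebraMap E Ω b) := by
        by_cases hx0 : v (algebraMap E Ω x) = 0
        · exact ⟨0, by rw [hx0, mul_zero]; exact zero_le⟩
        · obtain ⟨n, hn⟩ := exists_pow_lt_of_lt_one (div_pos hvb (pos_iff_ne_zero.2 hx0))
            (spectralValuation_p_lt_one p Ω)
          exact ⟨n, ((lt_div_iff₀ (pos_iff_ne_zero.2 hx0)).1 hn).le⟩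
      refine ⟨(p : L) ^ n * x, mem_fractionalIdeal_of_le (Ω := Ω) hbB ?_, ?_⟩
      · have : (((p : L) ^ n * x : L) : E) = (p : E) ^ n * x := by simp
        rw [this, map_mul, map_mul, map_pow, map_pow, map_natCast]
        exact hn
      · have h1 : ∀ η, φ ((p : L) ^ n * x) η = (p : Ω) ^ n * φ x η := by
          intro η
          rw [hφ, hφ, map_mul, map_pow, map_natCast]
        simp only [h1, mul_left_comm _ ((p : Ω) ^ n)]
        rw [← Finset.mul_sum]
        exact mul_ne_zero (pow_ne_zero _ (by exact_mod_cast hp.ne_zero)) hx)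
    -- Multiplication by an integer of the block field acts on coordinates through its embeddings;
    -- these are the separating characters.
    (fun η => (((IsScalarTower.toAlgHom K E Ω).comp (blockEmb hN hc m η) :
      blockField hN hc m →* Ω)).comp (extIntegers p K (blockField hN hc m)).toSubmonoid.subtype)
    (by
      intro η a
      refine (hvφ (IntermediateField.inclusion (blockField_le hN hc m) a) η).trans_le ?_
      have := (mem_extIntegers_iff (Ω := Ω) p (a : blockField hN hc m)).1 a.2
      exact this)
    (by
      intro η τ hτ
      rw [blockEmb_mul hN hc η hτ])
    (by
      intro η ν h
      refine pow_div_eq_one_of_blockEmb_eq hN hc hinj ?_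
      refine algHom_eq_of_isTame p K (Ω := Ω)
        (IntermediateField.inclusion (blockField_le hN hc m)) htame hfinrank fun x hx => ?_
      rw [map_sub]
      exact h ⟨x, hx⟩)
    (by
      intro r x hx
      let i := IntermediateField.inclusion (blockField_le hN hc m)
      have hr : i r ∈ extIntegers p K L := by
        rw [mem_extIntegers_iff p (Ω := Ω)]
        exact (mem_extIntegers_iff (Ω := Ω) p (r : blockField hN hc m)).1 r.2
      refine ⟨i r * x, (B : Submodule (extIntegers p K L) L).smul_mem ⟨i r, hr⟩ hx, fun η => ?_⟩
      rw [hφ, hφ, map_mul]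
      rfl)
  refine ⟨t, htB, fun z hz => ?_, fun x hx => ?_⟩
  · have h0 := htinj (fun η => algebraMap E Ω ((z : MonoidAlgebra E N).coeff η)) (fun ν => by
      refine (hact z t ν).symm.trans ?_
      rw [hz, map_zero]
      rfl)
    refine Subtype.ext (ext_coeff fun η => (algebraMap E Ω).injective ?_)
    exact (congrFun h0 η).trans (map_zero _).symm
  · obtain ⟨w, hw, hwi, hwx⟩ := hts x hx
    obtain ⟨h, hh⟩ := hinv w hwi
    refine ⟨h, hint h fun η => by rw [hh]; exact hw η, ?_⟩
    -- The coordinate at the identity is `x` itself, so one coordinate determines the element.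
    have h1 : φ (h • t) 1 = φ x 1 := by
      rw [hact, ← hwx]
      simp only [hh]
    exact Subtype.ext ((algebraMap E Ω).injective h1)

end

end HopfGaloisTame

end

/-! ### Passage to an algebraic closure of `E` and conclusion -/

theorem theorem5p3 (p : ℕ) [Fact p.Prime]
    {K E : Type*} [Field K] [Algebra ℚ_[p] K] [FiniteDimensional ℚ_[p] K]
    [Field E] [Algebra K E] [FiniteDimensional K E] [IsGalois K E]
    (L : IntermediateField K E) [IsNormalClosure K L E]
    (htame : HopfGaloisTame.IsTame p K L)
    (hacg : HopfGaloisTame.IsAlmostClassicallyGalois L)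
    (N : Subgroup (Equiv.Perm (HopfGaloisTame.Cosets L)))
    (hN : HopfGaloisTame.IsNormalizedByTranslations N)
    (hHG : HopfGaloisTame.GivesHopfGaloisStructure hN)
    (hcomm : ∀ z w : HopfGaloisTame.fixedAlgebra hN, z * w = w * z)
    (B : FractionalIdeal (nonZeroDivisors (HopfGaloisTame.extIntegers p K L)) L) :
    ∃ M : Submodule (HopfGaloisTame.integralFixedRing p hN) L,
      (∀ x : L, x ∈ M ↔ x ∈ B) ∧
      Module.Free (HopfGaloisTame.integralFixedRing p hN) M := by
  by_cases hB0 : B = 0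
  · refine ⟨⊥, fun x => ?_, inferInstance⟩
    rw [hB0, FractionalIdeal.mem_zero_iff, Submodule.mem_bot]
  let : Algebra ℚ_[p] E := ((algebraMap K E).comp (algebraMap ℚ_[p] K)).toAlgebra
  have : IsScalarTower ℚ_[p] K E := .of_algebraMap_eq fun _ => rfl
  have : FiniteDimensional ℚ_[p] E := .trans ℚ_[p] K E
  have : CharZero E := HopfGaloisTame.charZero_of_padic p E
  have : CharZero K := HopfGaloisTame.charZero_of_padic p K
  let Ω := AlgebraicClosure E
  have : CharZero Ω := charZero_of_injective_algebraMap (algebraMap E Ω).injective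
  have : Algebra.IsAlgebraic ℚ_[p] Ω := .trans ℚ_[p] E Ω
  have : IsScalarTower ℚ_[p] K Ω := .of_algebraMap_eq fun x => by
    rw [IsScalarTower.algebraMap_apply ℚ_[p] E Ω, IsScalarTower.algebraMap_apply K E Ω]
    rfl
  have : Algebra.IsAlgebraic K Ω := .trans K E Ω
  have : Normal K Ω := normal_iff.2 fun x =>
    ⟨(Algebra.IsAlgebraic.isAlgebraic x).isIntegral, IsAlgClosed.splits _⟩
  have : IsGalois E Ω := { }
  obtain ⟨t, htB, htinj, hts⟩ := HopfGaloisTame.exists_generator_fractionalIdeal (Ω := Ω) htame hN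
    hHG.bijective.2 hcomm hB0
  let M : Submodule (HopfGaloisTame.integralFixedRing p hN) L :=
    { carrier := {x | x ∈ B}
      add_mem' := fun hx hy =>
        (B : Submodule (HopfGaloisTame.extIntegers p K L) L).add_mem hx hy
      zero_mem' := (B : Submodule (HopfGaloisTame.extIntegers p K L) L).zero_mem
      smul_mem' := fun z _ hx => HopfGaloisTame.integralFixedRing_smul_mem (Ω := Ω) hx z.2 }
  refine ⟨M, fun x => Iff.rfl, ?_⟩
  refine Module.Free.of_equiv (LinearEquiv.ofBijective
    (LinearMap.toSpanSingleton (HopfGaloisTame.integralFixedRing p hN) M ⟨t, htB⟩) ⟨?_, ?_⟩)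
  · refine (injective_iff_map_eq_zero _).2 fun z hz => Subtype.ext (htinj z ?_)
    exact congrArg Subtype.val hz
  · rintro ⟨x, hx⟩
    obtain ⟨z, hz, hzx⟩ := hts x hx
    exact ⟨⟨z, hz⟩, Subtype.ext hzx⟩
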